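/- \textbf{Conventions.} Let $\kappa$ be a limit ordinal ($\kappa\neq 0$). A wide subcategory $\mathcal M$ of a category $\mathcal E$ \emph{has $\alpha$-indexed colimits in $\mathcal E$} if every diagram in $\mathcal M$ indexed by the poset $\alpha$ has a colimit in $\mathcal E$ which is also a colimit in $\mathcal M$ (the coprojections lie in $\mathcal M$, and so does the map induced by any cocone with legs in $\mathcal M$). It is \emph{closed under cobase change} if pushouts of $\mathcal M$-maps along arbitrary maps exist in $\mathcal E$ and the resulting cobase changes lie in $\mathcal M$. A \emph{$\kappa$-backdrop} is a wide subcategory which has $\alpha$-indexed colimits in $\mathcal E$ for all $0<\alpha\le\kappa$ and is closed under cobase change. A \emph{configuration for the free monad sequence} $(\mathcal E,\mathcal M,\mathsf T)\in\mathrm{Conf}_\kappa$ consists of a category $\mathcal E$, a $\kappa$-backdrop $\mathcal M$ in $\mathcal E$ and a pointed endofunctor $\mathsf T=(T,\tau)$ on $\mathcal E$ such that: every $\tau_A$ is in $\mathcal M$; for every $f\colon A\to B$ in $\mathcal M$ the induced map $B\sqcup_A TA\to TB$ is in $\mathcal M$; and $T$ preserves $\kappa$-indexed colimits of diagrams in $\mathcal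 M$. The \emph{free monad} on $\mathsf T$ is a monad $\mathsf M$ with a morphism of pointed endofunctors $\gamma$ from $\mathsf T$ to the underlying pointed endofunctor $\mathsf M^{\mathrm{pt}}$ of $\mathsf M$, through which every morphism of pointed endofunctors from $\mathsf T$ to (the underlying pointed endofunctor of) a monad factors by a unique morphism of monads. A \emph{notion of composable structure} on $\mathcal E$ is a pseudo double category $\mathbb A$ whose category of objects and horizontal morphisms is $\mathcal E$, with a (strict) double functor $U\colon\mathbb A\to\mathrm{Sq}(\mathcal E)$ to the double category of commutative squares which is the identity on $\mathcal E$ and such that $U_1\colon\mathbb A_1\to\mathrm{Arr}(\mathcal E)$ is a conservative isofibration; here $\mathbb A_1$ is the category of vertical morphisms and squares, with vertical domain and codomain functors $\mathrm{dom},\mathrm{cod}\colon\mathbb A_1\to\mathcal E$ and vertical composition $\star$. Let $\mathbb A_{\cong,\mathcal M}\subseteq\mathbb A_1$ be the wide subcategory of squares whose vertical domain is an isomorphism and whose vertical codomain is in $\mathcal M$. Then $U$ is \emph{$(\kappa,\mathcal M)$-cellular} if $\mathbb A_{\cong,\mathcal M}$ has $\alpha$-indexed colimits in $\mathbb A_1$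 for all $0<\alpha\le\kappa$ and is closed under cobase change in $\mathbb A_1$, and $U_1$ preserves these colimits and pushouts. An \emph{$\mathbb A$-point} $(\overline{\mathsf T},\theta)$ over $\mathsf T$ is a pointed endofunctor $\overline{\mathsf T}=(\overline T,\overline\tau)$ on $\mathbb A_1$ with strict equalities $\mathrm{dom}\,\overline T=\mathrm{dom}$, $\mathrm{dom}\,\overline\tau=\mathrm{id}$, $\mathrm{cod}\,\overline T=T\,\mathrm{cod}$, $\mathrm{cod}\,\overline\tau=\tau\,\mathrm{cod}$, together with a natural isomorphism $\theta_{g,f}\colon\overline T(g)\star f\cong\overline T(g\star f)$, for composable vertical morphisms $f,g$, with $\theta_{g,f}\circ(\overline\tau_g\star\mathrm{id}_f)=\overline\tau_{g\star f}$. A \emph{morphism of $\mathbb A$-points} $(\overline{\mathsf T},\theta)\to(\overline{\mathsf T'},\theta')$ over a morphism $\gamma\colon\mathsf T\to\mathsf T'$ is a morphism $\overline\gamma\colon\overline{\mathsf T}\to\overline{\mathsf T'}$ of pointed endofunctors with $\mathrm{dom}\,\overline\gamma=\mathrm{id}$, $\mathrm{cod}\,\overline\gamma=\gamma\,\mathrm{cod}$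 and $\theta'_{g,f}\circ(\overline\gamma_g\star\mathrm{id}_f)=\overline\gamma_{g\star f}\circ\theta_{g,f}$. An \emph{$\mathbb A$-point $(\overline{\mathsf M},\psi)$ over a monad $\mathsf M$} and \emph{morphisms} of these over monad morphisms are defined likewise, with $\overline{\mathsf M}$ a monad on $\mathbb A_1$ lying strictly over $\mathrm{Id}$ and $\mathsf M$ along $\mathrm{dom}$ and $\mathrm{cod}$ (units and multiplications included), $\psi$ also compatible with the multiplication, i.e. $\psi_{g,f}\circ(\overline\mu_g\star\mathrm{id}_f)=\overline\mu_{g\star f}\circ\overline M(\psi_{g,f})\circ\psi_{\overline M g,f}$, and morphisms being monad morphisms. Write $(\overline{\mathsf M}^{\mathrm{pt}},\psi)$ for the underlying $\mathbb A$-point over $\mathsf M^{\mathrm{pt}}$. \textbf{Theorem.} Let $(\mathcal E,\mathcal M,\mathsf T)\in\mathrm{Conf}_\kappa$, let $U\colon\mathbb A\to\mathrm{Sq}(\mathcal E)$ be a $(\kappa,\mathcal M)$-cellular notion of composable structure, and let $(\overline{\mathsf T},\theta)$ be an $\mathbb A$-point over $\mathsf T$. Then the free monad on $\mathsf T$ exists,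 and for any free monad $\mathsf M$ on $\mathsf T$, with canonical morphism $\gamma\colon\mathsf T\to\mathsf M^{\mathrm{pt}}$, there are (i) an $\mathbb A$-point $(\overline{\mathsf M},\psi)$ over $\mathsf M$, and (ii) a morphism of $\mathbb A$-points $\overline\gamma\colon(\overline{\mathsf T},\theta)\to(\overline{\mathsf M}^{\mathrm{pt}},\psi)$ over $\gamma$, such that (iii) for every monad morphism $\alpha\colon\mathsf M\to\mathsf M'$, every $\mathbb A$-point $(\overline{\mathsf M'},\psi')$ over $\mathsf M'$ and every morphism of $\mathbb A$-points $\overline\beta\colon(\overline{\mathsf T},\theta)\to(\overline{\mathsf M'}^{\mathrm{pt}},\psi')$ over $\alpha\gamma\colon\mathsf T\to\mathsf M'^{\mathrm{pt}}$, there is a unique morphism of $\mathbb A$-points $\overline\alpha\colon(\overline{\mathsf M},\psi)\to(\overline{\mathsf M'},\psi')$ over $\alpha$ with $\overline\alpha\,\overline\gamma=\overline\beta$. -/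

import Mathlib

open CategoryTheory CategoryTheory.Limits

universe w v u v' u'

namespace FreeMonadPoints

/-! ### Backdrops -/

section Backdrops

variable {E : Type u} [Category.{v} E]

/-- The wide subcategory `M` has `α`-indexed colimits in `E`: every diagram `α ⥤ E` with values in
`M` has a colimit in `E`, and this colimit is also a colimit in `M`, i.e. the coprojections lie in
`M`, and so does the map induced by any cocone whose legs lie in `M`.
The ordinal `α` is viewed as the poset of ordinals below it. -/
structure HasIndexedColimitsIn (α : Ordinal.{w}) (M : MorphismProperty E) : Prop where
  hasColimit : ∀ F : Set.Iio α ⥤ E, (∀ ⦃i j : Set.Iio α⦄ (f : i ⟶ j), M (F.map f)) → HasColimit F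
  ι_mem : ∀ F : Set.Iio α ⥤ E, (∀ ⦃i j : Set.Iio α⦄ (f : i ⟶ j), M (F.map f)) →
    ∀ (c : Cocone F), IsColimit c → ∀ i, M (c.ι.app i)
  desc_mem : ∀ F : Set.Iio α ⥤ E, (∀ ⦃i j : Set.Iio α⦄ (f : i ⟶ j), M (F.map f)) →
    ∀ (c : Cocone F) (hc : IsColimit c) (d : Cocone F), (∀ i, M (d.ι.app i)) → M (hc.desc d)

/-- `M` is closed under cobase change in `E`: pushouts of maps in `M` along arbitrary maps exist,
and every cobase change of a map in `M` is in `M`. -/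
structure ClosedUnderCobaseChange (M : MorphismProperty E) : Prop where
  hasPushout : ∀ ⦃A B C : E⦄ (f : A ⟶ B) (g : A ⟶ C), M f → HasPushout f g
  of_isPushout : ∀ ⦃A B C D : E⦄ {f : A ⟶ B} {g : A ⟶ C} {inl : B ⟶ D} {inr : C ⟶ D},
    IsPushout f g inl inr → M f → M inr

/-- A `κ`-backdrop in `E`: a wide subcategory with `α`-indexed colimits in `E` for `0 < α ≤ κ`,
closed under cobase change in `E`. -/
structure IsBackdrop (κ : Ordinal.{w}) (M : MorphismProperty E) : Prop where
  isMultiplicative : M.IsMultiplicative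
  hasIndexedColimitsIn : ∀ α : Ordinal.{w}, 0 < α → α ≤ κ → HasIndexedColimitsIn α M
  closedUnderCobaseChange : ClosedUnderCobaseChange M

end Backdrops

/-! ### Pointed endofunctors, free monads and configurations -/

/-- A pointed endofunctor `(T, τ)` on `E`. -/
structure PointedEndofunctor (E : Type u) [Category.{v} E] where
  functor : E ⥤ E
  unit : 𝟭 E ⟶ functor

/-- A morphism of pointed endofunctors. -/
@[ext]
structure PointedEndofunctor.Hom {E : Type u} [Category.{v} E] (T T' : PointedEndofunctor E) where
  nat : T.functor ⟶ T'.functor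
  unit_nat : T.unit ≫ nat = T'.unit

instance (E : Type u) [Category.{v} E] : Category (PointedEndofunctor E) where
  Hom T T' := PointedEndofunctor.Hom T T'
  id T := ⟨𝟙 _, Category.comp_id _⟩
  comp f g := ⟨f.nat ≫ g.nat, by rw [← Category.assoc, f.unit_nat, g.unit_nat]⟩
  id_comp _ := PointedEndofunctor.Hom.ext (Category.id_comp _)
  comp_id _ := PointedEndofunctor.Hom.ext (Category.comp_id _)
  assoc _ _ _ := PointedEndofunctor.Hom.ext (Category.assoc _ _ _)

section Configurations

variable {E : Type u} [Category.{v} E]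

/-- The underlying pointed endofunctor of a monad. -/
def underPtd (M : Monad E) : PointedEndofunctor E := ⟨M.toFunctor, M.η⟩

/-- The underlying morphism of pointed endofunctors of a morphism of monads. -/
def underPtdMap {M M' : Monad E} (α : M ⟶ M') : underPtd M ⟶ underPtd M' :=
  PointedEndofunctor.Hom.mk α.toNatTrans (by ext X; exact α.app_η X)

/-- The monad `M` with `γ : T ⟶ M` is the free monad on the pointed endofunctor `T`: any morphism of
pointed endofunctors from `T` to a monad factors through `γ` by a unique morphism of monads. -/
def IsFreeMonad {T : PointedEndofunctor E} {M : Monad E} (γ : T ⟶ underPtd M) : Prop :=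
  ∀ (M' : Monad E) (δ : T ⟶ underPtd M'), ∃! α : M ⟶ M', γ ≫ underPtdMap α = δ

/-- `(E, M, T)` is a configuration (with parameter `κ`) for the free monad sequence on a pointed
endofunctor `T = (T, τ)`. -/
structure IsConfiguration (κ : Ordinal.{w}) (M : MorphismProperty E) (T : PointedEndofunctor E) :
    Prop where
  /-- `M` is a `κ`-backdrop. -/
  backdrop : IsBackdrop κ M
  /-- The unit `τ` is valued in `M`. -/
  unit_mem : ∀ A : E, M (T.unit.app A)
  /-- `M` is closed under pushout application of `τ`: if `f : A ⟶ B` is in `M` then so is the induced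
  map `B ⊔_A T A ⟶ T B`. -/
  leibniz_mem : ∀ ⦃A B P : E⦄ (f : A ⟶ B) (inl : B ⟶ P) (inr : T.functor.obj A ⟶ P)
    (h : IsPushout f (T.unit.app A) inl inr), M f →
      M (h.desc (T.unit.app B) (T.functor.map f) (T.unit.naturality f))
  /-- `T` preserves `κ`-indexed colimits of diagrams in `M`. -/
  convergence : ∀ F : Set.Iio κ ⥤ E, (∀ ⦃i j : Set.Iio κ⦄ (f : i ⟶ j), M (F.map f)) →
    PreservesColimit F T.functor

end Configurations

/-! ### Pseudo double categories -/

/-- The objects of the category of vertical morphisms: triples of a source, a target, and a vertical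
morphism between them. -/
structure VerticalArrow {E : Type u} (Vert : E → E → Type u') where
  of ::
  {src : E}
  {tgt : E}
  arr : Vert src tgt

open VerticalArrow (of)

/-- A pseudo double category whose category of objects and horizontal morphisms is `E`.
The category of vertical morphisms and squares is the field `vertCategory`; its objects are sorted by
their source and target so that the strict equations between objects hold by definition.
A square `β : f ⟶ g` has the boundary `dmap β`, `cmap β`. -/
structure PseudoDoubleCategory (E : Type u) [Category.{v} E] where
  /-- vertical morphisms -/
  Vert : E → E → Type u'
  /-- squares, and their horizontal composition -/
  [vertCategory : Category.{v'} (VerticalArrow Vert)]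
  /-- action of the vertical domain functor on squares -/
  dmap : ∀ {f g : VerticalArrow Vert}, (f ⟶ g) → (f.src ⟶ g.src)
  dmap_id : ∀ f : VerticalArrow Vert, dmap (𝟙 f) = 𝟙 f.src
  dmap_comp : ∀ {f g h : VerticalArrow Vert} (β : f ⟶ g) (γ : g ⟶ h),
    dmap (β ≫ γ) = dmap β ≫ dmap γ
  /-- action of the vertical codomain functor on squares -/
  cmap : ∀ {f g : VerticalArrow Vert}, (f ⟶ g) → (f.tgt ⟶ g.tgt)
  cmap_id : ∀ f : VerticalArrow Vert, cmap (𝟙 f) = 𝟙 f.tgt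
  cmap_comp : ∀ {f g h : VerticalArrow Vert} (β : f ⟶ g) (γ : g ⟶ h),
    cmap (β ≫ γ) = cmap β ≫ cmap γ
  /-- vertical identities -/
  idv : ∀ A : E, Vert A A
  idvMap : ∀ {A B : E}, (A ⟶ B) → (of (idv A) ⟶ of (idv B))
  dmap_idvMap : ∀ {A B : E} (h : A ⟶ B), dmap (idvMap h) = h
  cmap_idvMap : ∀ {A B : E} (h : A ⟶ B), cmap (idvMap h) = h
  idvMap_id : ∀ A : E, idvMap (𝟙 A) = 𝟙 (of (idv A))
  idvMap_comp : ∀ {A B C : E} (h : A ⟶ B) (k : B ⟶ C), idvMap (h ≫ k) = idvMap h ≫ idvMap k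
  /-- vertical composition `g ⋆ f` of vertical morphisms -/
  vcomp : ∀ {A B C : E}, Vert B C → Vert A B → Vert A C
  /-- vertical composition `γ ⋆ β` of squares -/
  vcompMap : ∀ {A B C A' B' C' : E} {g : Vert B C} {f : Vert A B} {g' : Vert B' C'} {f' : Vert A' B'}
    (γ : of g ⟶ of g') (β : of f ⟶ of f'), dmap γ = cmap β → (of (vcomp g f) ⟶ of (vcomp g' f'))
  dmap_vcompMap : ∀ {A B C A' B' C' : E} {g : Vert B C} {f : Vert A B} {g' : Vert B' C'}
    {f' : Vert A' B'} (γ : of g ⟶ of g') (β : of f ⟶ of f') (h : dmap γ = cmap β),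
    dmap (vcompMap γ β h) = dmap β
  cmap_vcompMap : ∀ {A B C A' B' C' : E} {g : Vert B C} {f : Vert A B} {g' : Vert B' C'}
    {f' : Vert A' B'} (γ : of g ⟶ of g') (β : of f ⟶ of f') (h : dmap γ = cmap β),
    cmap (vcompMap γ β h) = cmap γ
  vcompMap_id : ∀ {A B C : E} (g : Vert B C) (f : Vert A B),
    vcompMap (𝟙 (of g)) (𝟙 (of f)) ((dmap_id (of g)).trans (cmap_id (of f)).symm) = 𝟙 (of (vcomp g f))
  vcompMap_comp : ∀ {A B C A' B' C' A'' B'' C'' : E} {g : Vert B C} {f : Vert A B} {g' : Vert B' C'}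
    {f' : Vert A' B'} {g'' : Vert B'' C''} {f'' : Vert A'' B''}
    (γ : of g ⟶ of g') (β : of f ⟶ of f') (h : dmap γ = cmap β)
    (γ' : of g' ⟶ of g'') (β' : of f' ⟶ of f'') (h' : dmap γ' = cmap β'),
    vcompMap (γ ≫ γ') (β ≫ β') (by rw [dmap_comp, cmap_comp, h, h']) =
      vcompMap γ β h ≫ vcompMap γ' β' h'
  /-- the associator -/
  assoc : ∀ {A B C D : E} (h : Vert C D) (g : Vert B C) (f : Vert A B),
    of (vcomp (vcomp h g) f) ≅ of (vcomp h (vcomp g f))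
  dmap_assoc : ∀ {A B C D : E} (h : Vert C D) (g : Vert B C) (f : Vert A B),
    dmap (assoc h g f).hom = 𝟙 A
  cmap_assoc : ∀ {A B C D : E} (h : Vert C D) (g : Vert B C) (f : Vert A B),
    cmap (assoc h g f).hom = 𝟙 D
  assoc_naturality : ∀ {A B C D A' B' C' D' : E} {h : Vert C D} {g : Vert B C} {f : Vert A B}
    {h' : Vert C' D'} {g' : Vert B' C'} {f' : Vert A' B'}
    (δ : of h ⟶ of h') (γ : of g ⟶ of g') (β : of f ⟶ of f')
    (e₁ : dmap δ = cmap γ) (e₂ : dmap γ = cmap β),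
    vcompMap (vcompMap δ γ e₁) β ((dmap_vcompMap δ γ e₁).trans e₂) ≫ (assoc h' g' f').hom =
      (assoc h g f).hom ≫ vcompMap δ (vcompMap γ β e₂) (e₁.trans (cmap_vcompMap γ β e₂).symm)
  /-- the unitor for `idv ⋆ f` -/
  leftUnitor : ∀ {A B : E} (f : Vert A B), of (vcomp (idv B) f) ≅ of f
  dmap_leftUnitor : ∀ {A B : E} (f : Vert A B), dmap (leftUnitor f).hom = 𝟙 A
  cmap_leftUnitor : ∀ {A B : E} (f : Vert A B), cmap (leftUnitor f).hom = 𝟙 B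
  leftUnitor_naturality : ∀ {A B A' B' : E} {f : Vert A B} {f' : Vert A' B'} (β : of f ⟶ of f'),
    vcompMap (idvMap (cmap β)) β (dmap_idvMap _) ≫ (leftUnitor f').hom = (leftUnitor f).hom ≫ β
  /-- the unitor for `f ⋆ idv` -/
  rightUnitor : ∀ {A B : E} (f : Vert A B), of (vcomp f (idv A)) ≅ of f
  dmap_rightUnitor : ∀ {A B : E} (f : Vert A B), dmap (rightUnitor f).hom = 𝟙 A
  cmap_rightUnitor : ∀ {A B : E} (f : Vert A B), cmap (rightUnitor f).hom = 𝟙 B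
  rightUnitor_naturality : ∀ {A B A' B' : E} {f : Vert A B} {f' : Vert A' B'} (β : of f ⟶ of f'),
    vcompMap β (idvMap (dmap β)) (cmap_idvMap _).symm ≫ (rightUnitor f').hom =
      (rightUnitor f).hom ≫ β
  pentagon : ∀ {A B C D F : E} (k : Vert D F) (h : Vert C D) (g : Vert B C) (f : Vert A B),
    vcompMap (assoc k h g).hom (𝟙 (of f)) ((dmap_assoc k h g).trans (cmap_id (of f)).symm) ≫
        (assoc k (vcomp h g) f).hom ≫
        vcompMap (𝟙 (of k)) (assoc h g f).hom ((dmap_id (of k)).trans (cmap_assoc h g f).symm) =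
      (assoc (vcomp k h) g f).hom ≫ (assoc k h (vcomp g f)).hom
  triangle : ∀ {A B C : E} (g : Vert B C) (f : Vert A B),
    (assoc g (idv B) f).hom ≫
        vcompMap (𝟙 (of g)) (leftUnitor f).hom ((dmap_id (of g)).trans (cmap_leftUnitor f).symm) =
      vcompMap (rightUnitor g).hom (𝟙 (of f)) ((dmap_rightUnitor g).trans (cmap_id (of f)).symm)

/-- The category of vertical morphisms and squares. -/
abbrev PseudoDoubleCategory.VertArr {E : Type u} [Category.{v} E]
    (A : PseudoDoubleCategory.{v, u, v', u'} E) : Type (max u u') :=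
  VerticalArrow A.Vert

instance {E : Type u} [Category.{v} E] (A : PseudoDoubleCategory.{v, u, v', u'} E) :
    Category.{v'} A.VertArr := A.vertCategory

/-! ### Notions of composable structure -/

/-- A double functor from `A` to the double category of commutative squares in `E` which is the
identity on objects and horizontal morphisms. As squares of the latter are determined by their
boundary, its action on squares amounts to the commutation `comm`. -/
structure DoubleFunctorToSquares {E : Type u} [Category.{v} E]
    (A : PseudoDoubleCategory.{v, u, v', u'} E) where
  /-- the underlying morphism of a vertical morphism -/
  und : ∀ {X Y : E}, A.Vert X Y → (X ⟶ Y)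
  comm : ∀ {f g : A.VertArr} (β : f ⟶ g), A.dmap β ≫ und g.arr = und f.arr ≫ A.cmap β
  und_idv : ∀ X : E, und (A.idv X) = 𝟙 X
  und_vcomp : ∀ {X Y Z : E} (g : A.Vert Y Z) (f : A.Vert X Y), und (A.vcomp g f) = und f ≫ und g

/-- The induced functor from vertical morphisms to the arrow category. -/
def DoubleFunctorToSquares.vert {E : Type u} [Category.{v} E]
    {A : PseudoDoubleCategory.{v, u, v', u'} E} (U : DoubleFunctorToSquares A) :
    A.VertArr ⥤ Arrow E where
  obj f := Arrow.mk (U.und f.arr)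
  map β := Arrow.homMk (A.dmap β) (A.cmap β) (U.comm β)
  map_id f := by ext <;> simp [A.dmap_id, A.cmap_id]
  map_comp β γ := by ext <;> simp [A.dmap_comp, A.cmap_comp]

/-- Isofibrations: isomorphisms `F X ≅ Y` lift strictly to isomorphisms out of `X`. -/
def IsIsofibration {C : Type*} {D : Type*} [Category C] [Category D] (F : C ⥤ D) : Prop :=
  ∀ (X : C) (Y : D) (e : F.obj X ≅ Y),
    ∃ (X' : C) (e' : X ≅ X') (h : F.obj X' = Y), F.map e'.hom ≫ eqToHom h = e.hom

/-- A notion of composable structure on `E`. -/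
structure NotionOfComposableStructure {E : Type u} [Category.{v} E]
    (A : PseudoDoubleCategory.{v, u, v', u'} E) extends DoubleFunctorToSquares A where
  conservative : toDoubleFunctorToSquares.vert.ReflectsIsomorphisms
  isofibration : IsIsofibration toDoubleFunctorToSquares.vert

section Cellular

variable {E : Type u} [Category.{v} E] {A : PseudoDoubleCategory.{v, u, v', u'} E}

/-- The wide subcategory of `A.VertArr` of squares whose vertical domain is an isomorphism and whose
vertical codomain belongs to `M`. -/
def codClass (A : PseudoDoubleCategory.{v, u, v', u'} E) (M : MorphismProperty E) :
    MorphismProperty A.VertArr :=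
  fun _ _ β => IsIso (A.dmap β) ∧ M (A.cmap β)

/-- `(κ, M)`-cellular notions of composable structure. -/
structure NotionOfComposableStructure.IsCellular (U : NotionOfComposableStructure A)
    (κ : Ordinal.{w}) (M : MorphismProperty E) : Prop where
  hasIndexedColimitsIn : ∀ α : Ordinal.{w}, 0 < α → α ≤ κ → HasIndexedColimitsIn α (codClass A M)
  preserves_indexedColimits : ∀ α : Ordinal.{w}, 0 < α → α ≤ κ → ∀ F : Set.Iio α ⥤ A.VertArr,
    (∀ ⦃i j : Set.Iio α⦄ (f : i ⟶ j), codClass A M (F.map f)) → PreservesColimit F U.vert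
  closedUnderCobaseChange : ClosedUnderCobaseChange (codClass A M)
  preserves_pushouts : ∀ ⦃f g h : A.VertArr⦄ (β : f ⟶ g) (γ : f ⟶ h), codClass A M β →
    PreservesColimit (span β γ) U.vert

end Cellular

/-! ### Points -/

section Points

variable {E : Type u} [Category.{v} E]

/-- An endofunctor of `A.VertArr` lying strictly over the identity functor along the vertical domain,
and strictly over `T` along the vertical codomain. -/
structure LiftedEndofunctor (A : PseudoDoubleCategory.{v, u, v', u'} E) (T : E ⥤ E) where
  obj : ∀ {X Y : E}, A.Vert X Y → A.Vert X (T.obj Y)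
  map : ∀ {f g : A.VertArr}, (f ⟶ g) → (of (obj f.arr) ⟶ of (obj g.arr))
  map_id : ∀ f : A.VertArr, map (𝟙 f) = 𝟙 (of (obj f.arr))
  map_comp : ∀ {f g h : A.VertArr} (β : f ⟶ g) (γ : g ⟶ h), map (β ≫ γ) = map β ≫ map γ
  dmap_map : ∀ {f g : A.VertArr} (β : f ⟶ g), A.dmap (map β) = A.dmap β
  cmap_map : ∀ {f g : A.VertArr} (β : f ⟶ g), A.cmap (map β) = T.map (A.cmap β)

/-- The underlying endofunctor of `A.VertArr`. -/
def LiftedEndofunctor.functor {A : PseudoDoubleCategory.{v, u, v', u'} E} {T : E ⥤ E}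
    (L : LiftedEndofunctor A T) : A.VertArr ⥤ A.VertArr where
  obj f := of (L.obj f.arr)
  map β := L.map β
  map_id f := L.map_id f
  map_comp β γ := L.map_comp β γ

/-- For a square `γ` with identity vertical domain, the square `γ ⋆ id_f`. -/
def whisker (A : PseudoDoubleCategory.{v, u, v', u'} E) {X Y Z Z' : E} {g : A.Vert Y Z}
    {g' : A.Vert Y Z'} (γ : of g ⟶ of g') (hγ : A.dmap γ = 𝟙 Y) (f : A.Vert X Y) :
    of (A.vcomp g f) ⟶ of (A.vcomp g' f) :=
  A.vcompMap γ (𝟙 (of f)) (hγ.trans (A.cmap_id (of f)).symm)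

/-- An `A`-point over the pointed endofunctor `T`. The fields up to `cmap_unit` say that we have a
pointed endofunctor on `A.VertArr`, strictly over `Id` and over `T` along the vertical domain and
codomain; the remaining ones say that `θ`, with components `T̄ g ⋆ f ≅ T̄ (g ⋆ f)`, makes the vertical
composition a strong morphism of pointed endofunctors. -/
structure Point (A : PseudoDoubleCategory.{v, u, v', u'} E) (T : PointedEndofunctor E) where
  lift : LiftedEndofunctor A T.functor
  unit : 𝟭 A.VertArr ⟶ lift.functor
  dmap_unit : ∀ f : A.VertArr, A.dmap (unit.app f) = 𝟙 f.src
  cmap_unit : ∀ f : A.VertArr, A.cmap (unit.app f) = T.unit.app f.tgt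
  θ : ∀ {X Y Z : E} (g : A.Vert Y Z) (f : A.Vert X Y),
    of (A.vcomp (lift.obj g) f) ≅ of (lift.obj (A.vcomp g f))
  θ_naturality : ∀ {X Y Z X' Y' Z' : E} {g : A.Vert Y Z} {f : A.Vert X Y} {g' : A.Vert Y' Z'}
    {f' : A.Vert X' Y'} (γ : of g ⟶ of g') (β : of f ⟶ of f') (h : A.dmap γ = A.cmap β),
    A.vcompMap (lift.map γ) β ((lift.dmap_map γ).trans h) ≫ (θ g' f').hom =
      (θ g f).hom ≫ lift.map (A.vcompMap γ β h)
  unit_θ : ∀ {X Y Z : E} (g : A.Vert Y Z) (f : A.Vert X Y),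
    whisker A (unit.app (of g)) (dmap_unit (of g)) f ≫ (θ g f).hom = unit.app (of (A.vcomp g f))

/-- A morphism of `A`-points over a morphism `γ` of pointed endofunctors. -/
@[ext]
structure PointHom {A : PseudoDoubleCategory.{v, u, v', u'} E} {T T' : PointedEndofunctor E}
    (P : Point A T) (P' : Point A T') (γ : T ⟶ T') where
  nat : P.lift.functor ⟶ P'.lift.functor
  unit_nat : P.unit ≫ nat = P'.unit
  dmap_nat : ∀ f : A.VertArr, A.dmap (nat.app f) = 𝟙 f.src
  cmap_nat : ∀ f : A.VertArr, A.cmap (nat.app f) = γ.nat.app f.tgt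
  nat_θ : ∀ {X Y Z : E} (g : A.Vert Y Z) (f : A.Vert X Y),
    whisker A (nat.app (of g)) (dmap_nat (of g)) f ≫ (P'.θ g f).hom =
      (P.θ g f).hom ≫ nat.app (of (A.vcomp g f))

/-- An `A`-point over the monad `M`: an `A`-point over its underlying pointed endofunctor, with a
multiplication strictly over the multiplication of `M`, making the lifted functor a monad on
`A.VertArr` and making the vertical composition a strong morphism of monads. -/
structure MonadPoint (A : PseudoDoubleCategory.{v, u, v', u'} E) (M : Monad E) extends
    Point A (underPtd M) where
  mul : lift.functor ⋙ lift.functor ⟶ lift.functor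
  dmap_mul : ∀ f : A.VertArr, A.dmap (mul.app f) = 𝟙 f.src
  cmap_mul : ∀ f : A.VertArr, A.cmap (mul.app f) = M.μ.app f.tgt
  unit_mul : ∀ f : A.VertArr,
    unit.app (lift.functor.obj f) ≫ mul.app f = 𝟙 (lift.functor.obj f)
  map_unit_mul : ∀ f : A.VertArr,
    lift.functor.map (unit.app f) ≫ mul.app f = 𝟙 (lift.functor.obj f)
  mul_assoc : ∀ f : A.VertArr,
    lift.functor.map (mul.app f) ≫ mul.app f = mul.app (lift.functor.obj f) ≫ mul.app f
  mul_θ : ∀ {X Y Z : E} (g : A.Vert Y Z) (f : A.Vert X Y),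
    whisker A (mul.app (of g)) (dmap_mul (of g)) f ≫ (θ g f).hom =
      (θ (lift.obj g) f).hom ≫ lift.map (θ g f).hom ≫ mul.app (of (A.vcomp g f))

/-- A morphism of `A`-points over a morphism `α` of monads. -/
@[ext]
structure MonadPointHom {A : PseudoDoubleCategory.{v, u, v', u'} E} {M M' : Monad E}
    (P : MonadPoint A M) (P' : MonadPoint A M') (α : M ⟶ M') extends
    PointHom P.toPoint P'.toPoint (underPtdMap α) where
  mul_nat : ∀ f : A.VertArr,
    P.mul.app f ≫ nat.app f =
      P.lift.functor.map (nat.app f) ≫ nat.app (P'.lift.functor.obj f) ≫ P'.mul.app f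

end Points

end FreeMonadPoints

open FreeMonadPoints

/-!
Free algebras for a pointed endofunctor `T` are built by the free algebra sequence of Kelly. It
starts with `Z_0 = X` and `Z_1 = T X`, is continued at a limit ordinal by the colimit, and after
`Z_k` by the pushout of `q : Q_k ⟶ T Z_k` along `p : Q_k ⟶ Z_k`, where `Q_k` is the colimit over
`i < k` of the pushouts `Z_k ⊔_{Z_i} T Z_i`. Closure of the backdrop `M` under pushout application
of the unit puts `q`, and hence all transition maps, in `M`, so that the colimits needed exist; `T`
preserves the colimit at `κ`, so that `Z_κ` is an algebra. All stages have one uniform universal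
property, `ActionSequence.Stage.IsUniversal`: a map out of `Z_j` is a compatible family of maps out
of the `T Z_i`, `i < j`. Hence a map from `X` to an algebra extends uniquely along the sequence.

A choice of free algebras is the same as a free monad: free algebras form a monad which is free
(`FreeAlgebras.isFreeMonad`), and any other free monad is isomorphic to it, so that its values are
again free algebras (`IsFreeMonad.isFreeAlgebra`).

The same theory applies to vertical morphisms. If `U` is cellular, then squares which are invertible
on domains and in `M` on codomains, with the pointed endofunctor of an `A`-point, form a
configuration (`IsConfiguration.vertical`), so every vertical morphism `g` has a free algebra. Two
points need care.

* Free algebras on vertical morphisms have to lie strictly over those of the given free monad. The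
  vertical codomain functor preserves the colimits in the construction, so the codomain of the free
  algebra on `g` is the free algebra on the codomain of `g`, and its domain is that of `g` up to
  isomorphism. The isofibration property of `U` makes both identifications strict
  (`exists_strict_freeAlgebra`).
* The isomorphism `ψ` must be constructed. If `ḡ` is the free algebra on `g`, then `θ` makes `ḡ ⋆ f`
  an algebra, whence a comparison map from the free algebra on `g ⋆ f` to `ḡ ⋆ f`. By conservativity
  of `U` it is invertible as soon as its codomain is. That codomain compares the free algebra on an
  object `Z` with the same object, its action being twisted by the codomain of `θ`, an automorphism
  of `T` applied to it. For this reason the universal property of the sequence is proved along a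
  functor `V` and relative to a natural family `V T ⟶ T' V` (`IsFreeAlong`). With `V` the vertical
  codomain functor and with the family given by `θ`, it says that the twisted algebra is free as
  well.

The coherence laws of the resulting `A`-point and the uniqueness of induced morphisms are equations
between maps of algebras out of free algebras, so they are checked on generators. The universal
property in the theorem is that of the free monad on vertical morphisms; it lies strictly over that
of the free monad on `E`, by uniqueness of maps of algebras in `E`.
-/

universe v₁ u₁ v₂ u₂

namespace FreeMonadPoints

/-! ### Sequences with partial actions -/

section Sequences

variable {E : Type u} [Category.{v} E]

/-- A sequence of objects under `X` indexed by the ordinals below `α`, with a map `T Z_i ⟶ Z_j` for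
all `i < j`. No equations are imposed; see `ActionSequence.IsChain`. -/
structure ActionSequence (T : PointedEndofunctor E) (X : E) (α : Ordinal.{w}) where
  obj : Set.Iio α → E
  base : ∀ i, X ⟶ obj i
  act : ∀ {i j : Set.Iio α}, i < j → (T.functor.obj (obj i) ⟶ obj j)

variable {T : PointedEndofunctor E} {X : E} {α : Ordinal.{w}}

namespace ActionSequence

/-- The initial segment of length `β` of a sequence. -/
def restrict (S : ActionSequence T X α) {β : Ordinal.{w}} (h : β ≤ α) : ActionSequence T X β where
  obj i := S.obj ⟨i.1, i.2.trans_le h⟩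
  base _ := S.base _
  act hij := S.act hij

/-- What has to be added to a sequence of length `α` to obtain a sequence of length `α + 1`. -/
structure Stage (S : ActionSequence T X α) where
  pt : E
  base : X ⟶ pt
  leg : ∀ i, T.functor.obj (S.obj i) ⟶ pt

/-- The member of index `j` of a sequence, as a stage on top of its predecessors. -/
def stage (S : ActionSequence T X α) (j : Set.Iio α) : (S.restrict (le_of_lt j.2)).Stage where
  pt := S.obj j
  base := S.base j
  leg i := S.act (Subtype.mk_lt_mk.2 i.2)

/-- The transition map `Z_i ⟶ Z_j`. -/
def link (S : ActionSequence T X α) {i j : Set.Iio α} (h : i < j) : S.obj i ⟶ S.obj j :=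
  T.unit.app (S.obj i) ≫ S.act h

/-- The transition map from `Z_i` to a stage on top. -/
def Stage.link {S : ActionSequence T X α} (s : S.Stage) (i : Set.Iio α) : S.obj i ⟶ s.pt :=
  T.unit.app (S.obj i) ≫ s.leg i

end ActionSequence

/-- A stage whose predecessors are recorded as mere objects. Transfinite recursion produces these, as
their type does not depend on earlier values. -/
structure RawStage (T : PointedEndofunctor E) (X : E) (α : Ordinal.{w}) where
  prev : Set.Iio α → E
  pt : E
  base : X ⟶ pt
  leg : ∀ i, T.functor.obj (prev i) ⟶ pt

namespace RawStage

instance : Inhabited (RawStage T X α) :=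
  ⟨⟨fun _ => X, T.functor.obj X, T.unit.app X, fun _ => 𝟙 _⟩⟩

/-- The sequence given by a coherent family of raw stages. -/
def toSequence (R : ∀ β : Ordinal.{w}, β < α → RawStage T X β)
    (h : ∀ (β : Ordinal.{w}) (hβ : β < α) (i : Set.Iio β),
      (R β hβ).prev i = (R i.1 (i.2.trans hβ)).pt) :
    ActionSequence T X α where
  obj i := (R i.1 i.2).pt
  base i := (R i.1 i.2).base
  act {i j} hij := T.functor.map (eqToHom (h j.1 j.2 ⟨i.1, hij⟩).symm) ≫ (R j.1 j.2).leg ⟨i.1, hij⟩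

/-- A raw stage whose recorded predecessors are the members of a sequence. -/
def toStage (S : ActionSequence T X α) (r : RawStage T X α) (h : ∀ i, r.prev i = S.obj i) :
    S.Stage where
  pt := r.pt
  base := r.base
  leg i := T.functor.map (eqToHom (h i).symm) ≫ r.leg i

theorem exists_toStage {S : ActionSequence T X α} (s : S.Stage) (r : RawStage T X α)
    (e : r = ⟨S.obj, s.pt, s.base, s.leg⟩) :
    ∃ h : ∀ i, r.prev i = S.obj i, toStage S r h = s := by
  subst e
  refine ⟨fun _ => rfl, ?_⟩
  simp [toStage]

open Classical in
/-- One step of the recursion: choose a good stage on top of the previous ones, if there is one. -/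
noncomputable def next (Good : ∀ {α : Ordinal.{w}} (S : ActionSequence T X α), S.Stage → Prop)
    (α : Ordinal.{w}) (R : ∀ β : Ordinal.{w}, β < α → RawStage T X β) : RawStage T X α :=
  if h : ∃ h : (∀ (β : Ordinal.{w}) (hβ : β < α) (i : Set.Iio β),
      (R β hβ).prev i = (R i.1 (i.2.trans hβ)).pt), ∃ s, Good (toSequence R h) s then
    ⟨(toSequence R h.1).obj, h.2.choose.pt, h.2.choose.base, h.2.choose.leg⟩
  else default

end RawStage

open RawStage in
/-- Dependent transfinite recursion: if a good stage can be put on top of every sequence of good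
stages, then there is a sequence of good stages. -/
theorem exists_actionSequence {κ : Ordinal.{w}}
    (Good : ∀ {α : Ordinal.{w}} (S : ActionSequence T X α), S.Stage → Prop)
    (step : ∀ α < κ, ∀ S : ActionSequence T X α, (∀ j, Good _ (S.stage j)) → ∃ s, Good S s) :
    ∃ S : ActionSequence T X κ, ∀ j, Good _ (S.stage j) := by
  let R : ∀ α : Ordinal.{w}, RawStage T X α := fun α =>
    WellFounded.fix (C := fun α => RawStage T X α) (wellFounded_lt (α := Ordinal.{w})) (next Good) α
  have hR : ∀ α, R α = next Good α (fun β _ => R β) := fun α => WellFounded.fix_eq _ _ _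
  have key : ∀ α < κ, ∃ (h : ∀ β < α, ∀ i : Set.Iio β, (R β).prev i = (R i.1).pt)
      (hα : ∀ i, (R α).prev i = (R i.1).pt),
      Good (toSequence (fun β (_ : β < α) => R β) h) (toStage _ (R α) hα) := by
    intro α
    induction α using WellFoundedLT.induction with
    | ind α ih =>
      intro hα
      have h : ∀ β < α, ∀ i : Set.Iio β, (R β).prev i = (R i.1).pt := fun β hβ =>
        (ih β hβ (hβ.trans hα)).2.1
      have hs := step α hα (toSequence (fun β (_ : β < α) => R β) h)
        (fun j => (ih j.1 j.2 (lt_trans j.2 hα)).2.2)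
      obtain ⟨h', e⟩ := exists_toStage hs.choose (R α) (by
        rw [hR, next, dif_pos ⟨h, hs⟩])
      exact ⟨h, h', by rw [e]; exact hs.choose_spec⟩
  exact ⟨toSequence (fun β (_ : β < κ) => R β) (fun β hβ => (key β hβ).2.1),
    fun j => (key j.1 j.2).2.2⟩

end Sequences

/-! ### Functors on a partial order given by their values on strict inequalities -/

section FunctorOfLT

variable {C : Type u} [Category.{v} C] {I : Type w} [PartialOrder I]

open Classical in
/-- A functor on a partial order, from a family of maps indexed by the strict inequalities. -/
noncomputable def functorOfLT (obj : I → C) (map : ∀ {i j : I}, i < j → (obj i ⟶ obj j))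
    (comp : ∀ {i j k : I} (h : i < j) (h' : j < k), map h ≫ map h' = map (h.trans h')) : I ⥤ C where
  obj := obj
  map {i j} f := if h : i = j then eqToHom (by rw [h]) else map (lt_of_le_of_ne (leOfHom f) h)
  map_id i := by simp
  map_comp {i j k} f g := by
    rcases eq_or_lt_of_le (leOfHom f) with rfl | hf
    · simp
    rcases eq_or_lt_of_le (leOfHom g) with rfl | hg
    · simp
    rw [dif_neg hf.ne, dif_neg hg.ne, dif_neg (hf.trans hg).ne, comp]

variable {obj : I → C} {map : ∀ {i j : I}, i < j → (obj i ⟶ obj j)}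
    {comp : ∀ {i j k : I} (h : i < j) (h' : j < k), map h ≫ map h' = map (h.trans h')}

theorem functorOfLT_map {i j : I} (h : i < j) (f : i ⟶ j) :
    (functorOfLT obj map comp).map f = map h :=
  dif_neg h.ne

theorem functorOfLT_map_mem (M : MorphismProperty C) [M.IsMultiplicative]
    (hM : ∀ {i j : I} (h : i < j), M (map h)) {i j : I} (f : i ⟶ j) :
    M ((functorOfLT obj map comp).map f) := by
  rcases eq_or_lt_of_le (leOfHom f) with rfl | hf
  · have : f = 𝟙 _ := rfl
    rw [this, CategoryTheory.Functor.map_id]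
    exact M.id_mem _
  · rw [functorOfLT_map hf]
    exact hM hf

/-- A cocone on a functor indexed by a partial order, checked on strict inequalities. -/
def coconeOfLT (F : I ⥤ C) {W : C} (ι : ∀ i, F.obj i ⟶ W)
    (w : ∀ {i j : I} (h : i < j), F.map (homOfLE h.le) ≫ ι j = ι i) : Cocone F where
  pt := W
  ι :=
    { app := ι
      naturality := fun i j f => by
        rcases eq_or_lt_of_le (leOfHom f) with rfl | hf
        · have : f = 𝟙 _ := rfl
          simp [this]
        · obtain rfl : f = homOfLE hf.le := Subsingleton.elim _ _
          simpa using w hf }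

end FunctorOfLT

/-! ### Backdrops -/

section BackdropLemmas

variable {E : Type u} [Category.{v} E] {M : MorphismProperty E} {T : PointedEndofunctor E}
  {κ : Ordinal.{w}}

/-- Being closed under pushout application of the unit, `T` preserves the backdrop. -/
theorem IsConfiguration.map_mem (hT : IsConfiguration κ M T) {A B : E} (f : A ⟶ B) (hf : M f) :
    M (T.functor.map f) := by
  have := hT.backdrop.isMultiplicative
  have hM := hT.backdrop.closedUnderCobaseChange
  have := hM.hasPushout f (T.unit.app A) hf
  have sq := IsPushout.of_hasPushout f (T.unit.app A)
  rw [← sq.inr_desc (T.unit.app B) (T.functor.map f) (T.unit.naturality f)]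
  exact M.comp_mem _ _ (hM.of_isPushout sq hf) (hT.leibniz_mem f _ _ sq hf)

/-- `V` preserves pushouts of maps in `M`, and colimits of sequences in `M` of length at most `κ`. -/
structure PreservesCells (κ : Ordinal.{w}) (M : MorphismProperty E) {D : Type u₁} [Category.{v₁} D]
    (V : E ⥤ D) : Prop where
  isPushout : ∀ ⦃A B C P : E⦄ {f : A ⟶ B} {g : A ⟶ C} {inl : B ⟶ P} {inr : C ⟶ P},
    IsPushout f g inl inr → M f → IsPushout (V.map f) (V.map g) (V.map inl) (V.map inr)
  preservesColimit : ∀ α : Ordinal.{w}, 0 < α → α ≤ κ → ∀ F : Set.Iio α ⥤ E,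
    (∀ ⦃i j : Set.Iio α⦄ (f : i ⟶ j), M (F.map f)) → PreservesColimit F V

theorem PreservesCells.id (κ : Ordinal.{w}) (M : MorphismProperty E) : PreservesCells κ M (𝟭 E) where
  isPushout _ _ _ _ _ _ _ _ h _ := h
  preservesColimit _ _ _ _ _ := inferInstance

end BackdropLemmas

/-! ### The free algebra sequence -/

section Chains

variable {E : Type u} [Category.{v} E] {T : PointedEndofunctor E} {X : E} {α κ : Ordinal.{w}}
  {M : MorphismProperty E}

namespace ActionSequence

/-- The equations of a sequence of partial actions: acting is compatible with the transition maps in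
both variables, and the transition maps are maps under `X`. -/
structure IsChain (S : ActionSequence T X α) : Prop where
  link_act : ∀ {i j k : Set.Iio α} (h : i < j) (h' : j < k),
    S.act h ≫ S.link h' = S.act (h.trans h')
  map_link_act : ∀ {i j k : Set.Iio α} (h : i < j) (h' : j < k),
    T.functor.map (S.link h) ≫ S.act h' = S.act (h.trans h')
  base_link : ∀ {i j : Set.Iio α} (h : i < j), S.base i ≫ S.link h = S.base j

/-- The equations saying that a stage prolongs a chain. -/
structure Stage.IsChain {S : ActionSequence T X α} (s : S.Stage) : Prop where
  act_link : ∀ {i j : Set.Iio α} (h : i < j), S.act h ≫ s.link j = s.leg i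
  map_link_leg : ∀ {i j : Set.Iio α} (h : i < j), T.functor.map (S.link h) ≫ s.leg j = s.leg i
  base_link : ∀ i, S.base i ≫ s.link i = s.base

variable {S : ActionSequence T X α}

theorem IsChain.link_link (hS : S.IsChain) {i j k : Set.Iio α} (h : i < j) (h' : j < k) :
    S.link h ≫ S.link h' = S.link (h.trans h') := by
  rw [link, Category.assoc, hS.link_act, link]

theorem Stage.IsChain.link_link {s : S.Stage} (hs : s.IsChain) {i j : Set.Iio α} (h : i < j) :
    S.link h ≫ s.link j = s.link i := by
  rw [ActionSequence.link, Category.assoc, hs.act_link, Stage.link]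

theorem isChain_of_stage (h : ∀ j, (S.stage j).IsChain) : S.IsChain where
  link_act {i j k} hij hjk := (h k).act_link (i := ⟨i.1, hij.trans hjk⟩) (j := ⟨j.1, hjk⟩) hij
  map_link_act {i j k} hij hjk :=
    (h k).map_link_leg (i := ⟨i.1, hij.trans hjk⟩) (j := ⟨j.1, hjk⟩) hij
  base_link {i j} hij := (h j).base_link ⟨i.1, hij⟩

/-- An index below `k`, as an index of the whole sequence. -/
abbrev below (k : Set.Iio α) (i : Set.Iio k.1) : Set.Iio α :=
  ⟨i.1, (Set.mem_Iio.1 i.2).trans k.2⟩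

theorem below_lt (k : Set.Iio α) (i : Set.Iio k.1) : below k i < k :=
  i.2

/-- The functor given by the objects and the transition maps of a chain. -/
noncomputable def toFunctor (S : ActionSequence T X α) (hS : S.IsChain) : Set.Iio α ⥤ E :=
  functorOfLT S.obj (fun h => S.link h) (fun h h' => hS.link_link h h')

theorem toFunctor_map (hS : S.IsChain) {i j : Set.Iio α} (h : i < j) (f : i ⟶ j) :
    (S.toFunctor hS).map f = S.link h :=
  functorOfLT_map h f

theorem toFunctor_map_mem [M.IsMultiplicative] (hS : S.IsChain)
    (hM : ∀ {i j : Set.Iio α} (h : i < j), M (S.link h)) {i j : Set.Iio α} (f : i ⟶ j) :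
    M ((S.toFunctor hS).map f) :=
  functorOfLT_map_mem M hM f

/-- The cocone on a chain with vertex a stage on top of it. -/
noncomputable def Stage.cocone {s : S.Stage} (hS : S.IsChain) (hs : s.IsChain) :
    Cocone (S.toFunctor hS) :=
  coconeOfLT (S.toFunctor hS) (W := s.pt) (fun i => s.link i) (fun h =>
    (congrArg (· ≫ s.link _) (toFunctor_map hS h _)).trans (hs.link_link h))

section Universal

variable {D : Type u₁} [Category.{v₁} D] (V : E ⥤ D)

/-- The compatible families of maps from the `V T Z_i` to `W` that a stage in the image of a functor
`V` should classify. -/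
structure IsCompatible (S : ActionSequence T X α) {W : D} (c : V.obj X ⟶ W)
    (u : ∀ i, V.obj (T.functor.obj (S.obj i)) ⟶ W) : Prop where
  act : ∀ {i j : Set.Iio α} (h : i < j),
    V.map (S.act h) ≫ V.map (T.unit.app (S.obj j)) ≫ u j = u i
  map_link : ∀ {i j : Set.Iio α} (h : i < j), V.map (T.functor.map (S.link h)) ≫ u j = u i
  base : ∀ i, V.map (S.base i) ≫ V.map (T.unit.app (S.obj i)) ≫ u i = c

theorem IsCompatible.link {V : E ⥤ D} {S : ActionSequence T X α} {W : D} {c : V.obj X ⟶ W}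
    {u : ∀ i, V.obj (T.functor.obj (S.obj i)) ⟶ W} (hu : S.IsCompatible V c u) {i j : Set.Iio α}
    (h : i < j) : V.map (S.link h) ≫ V.map (T.unit.app (S.obj j)) ≫ u j =
      V.map (T.unit.app (S.obj i)) ≫ u i := by
  rw [ActionSequence.link, V.map_comp, Category.assoc, hu.act]

/-- The image of a stage under `V` is universal among the compatible families. -/
def Stage.IsUniversal (s : S.Stage) : Prop :=
  ∀ ⦃W : D⦄ (c : V.obj X ⟶ W) (u : ∀ i, V.obj (T.functor.obj (S.obj i)) ⟶ W),
    S.IsCompatible V c u → ∃! d : V.obj s.pt ⟶ W, V.map s.base ≫ d = c ∧ ∀ i, V.map (s.leg i) ≫ d = u i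

end Universal

/-- A stage at a limit ordinal built as a colimit. -/
structure Stage.IsLimit (s : S.Stage) (hS : S.IsChain) (hs : s.IsChain) : Prop where
  isSuccLimit : Order.IsSuccLimit α
  isColimit : Nonempty (IsColimit (s.cocone hS hs))

/-- A stage after a stage of index `k`, built from the colimit `c` of the pushouts
`F_i = Z_k ⊔_{Z_i} T Z_i` for `i < k` by taking a pushout along the induced map `q : c ⟶ T Z_k`. -/
structure Stage.SuccCell (M : MorphismProperty E) (s : S.Stage) (k : Set.Iio α) where
  le_top : ∀ i, i ≤ k
  F : Set.Iio k.1 ⥤ E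
  F_mem : ∀ ⦃i j : Set.Iio k.1⦄ (f : i ⟶ j), M (F.map f)
  c : Cocone F
  isColimit : IsColimit c
  inl : ∀ i, S.obj k ⟶ F.obj i
  inr : ∀ i : Set.Iio k.1, T.functor.obj (S.obj (below k i)) ⟶ F.obj i
  isPushout : ∀ i : Set.Iio k.1, IsPushout (S.link (below_lt k i))
    (T.unit.app _) (inl i) (inr i)
  link_mem : ∀ i : Set.Iio k.1, M (S.link (below_lt k i))
  p : c.pt ⟶ S.obj k
  q : c.pt ⟶ T.functor.obj (S.obj k)
  inl_p : ∀ i, inl i ≫ c.ι.app i ≫ p = 𝟙 _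
  inr_p : ∀ i, inr i ≫ c.ι.app i ≫ p = S.act (below_lt k i)
  inl_q : ∀ i, inl i ≫ c.ι.app i ≫ q = T.unit.app _
  inr_q : ∀ i, inr i ≫ c.ι.app i ≫ q =
    T.functor.map (S.link (below_lt k i))
  q_mem : M q
  isPushout_q : IsPushout q p (s.leg k) (s.link k)

section

variable {D : Type u₁} [Category.{v₁} D] {V : E ⥤ D}

theorem Stage.isUniversal_of_isEmpty {s : S.Stage} (hα : IsEmpty (Set.Iio α)) [IsIso s.base] :
    s.IsUniversal V := fun W c u _ =>
  ⟨inv (V.map s.base) ≫ c, ⟨by simp, fun i => hα.elim i⟩, fun d hd => by simp [← hd.1]⟩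

theorem Stage.isUniversal_of_unique {s : S.Stage} (hs : s.IsChain) (k : Set.Iio α)
    (hk : ∀ i, i = k) [IsIso (s.leg k)] : s.IsUniversal V := fun W c u hu =>
  ⟨inv (V.map (s.leg k)) ≫ u k, ⟨by
      rw [← hs.base_link k, Stage.link]
      simp [hu.base k],
    fun i => by obtain rfl := hk i; simp⟩, fun d hd => by simp [← hd.2 k]⟩

theorem Stage.IsLimit.isUniversal {s : S.Stage} {hS : S.IsChain} {hs : s.IsChain}
    (h : s.IsLimit hS hs) (hV : PreservesCells κ M V) (hα : α ≤ κ) [M.IsMultiplicative]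
    (hM : ∀ {i j : Set.Iio α} (h : i < j), M (S.link h)) : s.IsUniversal V := by
  intro W c u hu
  obtain ⟨hc⟩ := h.isColimit
  have := hV.preservesColimit α (by simpa [pos_iff_ne_zero] using h.isSuccLimit.ne_bot) hα
    (S.toFunctor hS) (fun i j f => toFunctor_map_mem hS hM f)
  have hc' := isColimitOfPreserves V hc
  have ext : ∀ f g : V.obj s.pt ⟶ W,
      (∀ i, V.map (s.link i) ≫ f = V.map (s.link i) ≫ g) → f = g := fun f g h => hc'.hom_ext h
  obtain ⟨d, fac⟩ : ∃ d : V.obj s.pt ⟶ W,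
      ∀ i, V.map (s.link i) ≫ d = V.map (T.unit.app (S.obj i)) ≫ u i := by
    let t : Cocone (S.toFunctor hS ⋙ V) := coconeOfLT _ (W := W)
      (fun i => V.map (T.unit.app (S.obj i)) ≫ u i) (fun {i j} h =>
        (congrArg (fun f => V.map f ≫ V.map (T.unit.app (S.obj j)) ≫ u j)
          (toFunctor_map hS h _)).trans (hu.link h))
    exact ⟨hc'.desc t, fun i => hc'.fac t i⟩
  have succ : ∀ i : Set.Iio α, ∃ j, i < j := fun i =>
    ⟨⟨Order.succ i.1, h.isSuccLimit.succ_lt i.2⟩, Order.lt_succ i.1⟩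
  refine ⟨d, ⟨?_, fun i => ?_⟩, fun d' hd => ext _ _ fun i => ?_⟩
  · obtain ⟨i⟩ : Nonempty (Set.Iio α) :=
      ⟨⟨0, by simpa [pos_iff_ne_zero] using h.isSuccLimit.ne_bot⟩⟩
    rw [← hs.base_link i, V.map_comp, Category.assoc, fac, hu.base]
  · obtain ⟨j, hj⟩ := succ i
    rw [← hs.act_link hj, V.map_comp, Category.assoc, fac, hu.act]
  · rw [fac, Stage.link, V.map_comp, Category.assoc, hd.2]

theorem Stage.SuccCell.isUniversal {s : S.Stage} (hs : s.IsChain) {k : Set.Iio α}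
    (h : s.SuccCell M k) (hV : PreservesCells κ M V) (hα : α ≤ κ) (hk : 0 < k.1) :
    s.IsUniversal V := by
  intro W c u hu
  have := hV.preservesColimit k.1 hk ((le_of_lt k.2).trans hα) h.F h.F_mem
  have hc := isColimitOfPreserves V h.isColimit
  have sq := hV.isPushout h.isPushout_q h.q_mem
  -- The equations on `u` for indices below `k` say that `u k` coequalizes the two maps from the
  -- colimit of the pushouts, which is checked on each pushout.
  have w : V.map h.q ≫ u k = V.map h.p ≫ V.map (T.unit.app (S.obj k)) ≫ u k := by
    refine hc.hom_ext fun i => (hV.isPushout (h.isPushout i) (h.link_mem i)).hom_ext ?_ ?_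
    · have h₁ := congrArg V.map (h.inl_q i)
      have h₂ := congrArg V.map (h.inl_p i)
      rw [V.map_comp, V.map_comp] at h₁ h₂
      change V.map (h.inl i) ≫ V.map (h.c.ι.app i) ≫ V.map h.q ≫ _ =
        V.map (h.inl i) ≫ V.map (h.c.ι.app i) ≫ V.map h.p ≫ _
      rw [reassoc_of% h₁, reassoc_of% h₂, V.map_id, Category.id_comp]
    · have h₁ := congrArg V.map (h.inr_q i)
      have h₂ := congrArg V.map (h.inr_p i)
      rw [V.map_comp, V.map_comp] at h₁ h₂
      change V.map (h.inr i) ≫ V.map (h.c.ι.app i) ≫ V.map h.q ≫ _ =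
        V.map (h.inr i) ≫ V.map (h.c.ι.app i) ≫ V.map h.p ≫ _
      rw [reassoc_of% h₁, reassoc_of% h₂, hu.act, hu.map_link]
  obtain ⟨d, hd₁, hd₂⟩ : ∃ d : V.obj s.pt ⟶ W, V.map (s.leg k) ≫ d = u k ∧
      V.map (s.link k) ≫ d = V.map (T.unit.app (S.obj k)) ≫ u k :=
    ⟨sq.desc _ _ w, sq.inl_desc _ _ w, sq.inr_desc _ _ w⟩
  refine ⟨d, ⟨?_, fun i => ?_⟩, fun d' hd => sq.hom_ext ?_ ?_⟩
  · rw [← hs.base_link k, V.map_comp, Category.assoc, hd₂, hu.base]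
  · rcases (h.le_top i).eq_or_lt with rfl | hi
    · exact hd₁
    · rw [← hs.map_link_leg hi, V.map_comp, Category.assoc, hd₁, hu.map_link]
  · rw [hd.2, hd₁]
  · rw [hd₂, Stage.link, V.map_comp, Category.assoc, hd.2]

end

end ActionSequence

end Chains

/-! ### Existence of the stages -/

section Steps

variable {E : Type u} [Category.{v} E] {T : PointedEndofunctor E} {X : E} {α κ : Ordinal.{w}}
  {M : MorphismProperty E}

/-- For composable `f : A ⟶ B` and `g : B ⟶ C` with `f` in `M`, the map
`C ⊔_A T A ⟶ C ⊔_B T B` is a cobase change of the pushout application `B ⊔_A T A ⟶ T B` of the unit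
to `f`. -/
theorem IsConfiguration.desc_mem (hT : IsConfiguration κ M T) {A B C P P' : E} {f : A ⟶ B}
    {g : B ⟶ C} (hf : M f) {inl : C ⟶ P} {inr : T.functor.obj A ⟶ P} {inl' : C ⟶ P'}
    {inr' : T.functor.obj B ⟶ P'} (h : IsPushout (f ≫ g) (T.unit.app A) inl inr)
    (h' : IsPushout g (T.unit.app B) inl' inr') (φ : P ⟶ P') (hl : inl ≫ φ = inl')
    (hr : inr ≫ φ = T.functor.map f ≫ inr') : M φ := by
  have hM := hT.backdrop.closedUnderCobaseChange
  have := hM.hasPushout f (T.unit.app A) hf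
  have sq := IsPushout.of_hasPushout f (T.unit.app A)
  have nat : f ≫ T.unit.app B = T.unit.app A ≫ T.functor.map f := T.unit.naturality f
  have hl' := sq.inl_desc (T.unit.app B) (T.functor.map f) nat
  have hr' := sq.inr_desc (T.unit.app B) (T.functor.map f) nat
  have hmem := hT.leibniz_mem f _ _ sq hf
  generalize sq.desc (T.unit.app B) (T.functor.map f) nat = l at hl' hr' hmem
  let k : pushout f (T.unit.app A) ⟶ P := sq.desc (g ≫ inl) inr (by
    rw [← Category.assoc, h.w])
  have hk : pushout.inl f (T.unit.app A) ≫ k = g ≫ inl := sq.inl_desc _ _ _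
  have hk' : pushout.inr f (T.unit.app A) ≫ k = inr := sq.inr_desc _ _ _
  have sq₁ : IsPushout g (pushout.inl f (T.unit.app A)) inl k := by
    refine IsPushout.of_left (h₁₁ := f) (v₁₁ := T.unit.app A) (h₂₁ := pushout.inr f (T.unit.app A))
      ?_ hk.symm sq
    rw [hk']
    exact h
  refine hM.of_isPushout (f := l) (g := k) (inl := inr') ?_ hmem
  refine (IsPushout.of_top (h₁₁ := g) (v₁₁ := pushout.inl f (T.unit.app A)) (v₁₂ := inl) ?_ ?_
    sq₁).flip
  · rw [hl, hl']
    exact h'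
  · refine sq.hom_ext ?_ ?_
    · rw [reassoc_of% hk, hl, reassoc_of% hl', h'.w]
    · rw [reassoc_of% hk', hr, reassoc_of% hr']

namespace ActionSequence

variable {S : ActionSequence T X α}

section

variable (hS : S.IsChain) {k : Set.Iio α} (hk : ∀ i, i ≤ k) {Z : E}
    (x : T.functor.obj (S.obj k) ⟶ Z)

/-- The transition map to the last object of a chain. -/
noncomputable def topMap (i : Set.Iio α) : S.obj i ⟶ S.obj k :=
  (S.toFunctor hS).map (homOfLE (hk i))

theorem topMap_top : topMap hS hk k = 𝟙 _ :=
  (S.toFunctor hS).map_id k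

theorem topMap_of_lt {i : Set.Iio α} (h : i < k) : topMap hS hk i = S.link h :=
  toFunctor_map hS h _

theorem link_topMap {i j : Set.Iio α} (h : i < j) :
    S.link h ≫ topMap hS hk j = S.link (h.trans_le (hk j)) := by
  rcases (hk j).eq_or_lt with rfl | hj
  · rw [topMap_top, Category.comp_id]
  · rw [topMap_of_lt hS hk hj, hS.link_link]

/-- The stage determined by a map out of `T Z_k`, where `k` is the last index. -/
noncomputable abbrev topStage : S.Stage where
  pt := Z
  base := S.base k ≫ T.unit.app (S.obj k) ≫ x
  leg i := T.functor.map (topMap hS hk i) ≫ x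

theorem topStage_leg_top : (topStage hS hk x).leg k = x := by
  simp [topMap_top]

theorem topStage_link (i : Set.Iio α) :
    (topStage hS hk x).link i = topMap hS hk i ≫ T.unit.app (S.obj k) ≫ x := by
  have nat : topMap hS hk i ≫ T.unit.app (S.obj k) =
    T.unit.app (S.obj i) ≫ T.functor.map (topMap hS hk i) := T.unit.naturality _
  rw [Stage.link, ← reassoc_of% nat]

theorem topStage_isChain
    (hx : ∀ {i} (h : i < k), S.act h ≫ T.unit.app _ ≫ x = T.functor.map (S.link h) ≫ x) :
    (topStage hS hk x).IsChain where
  act_link {i j} h := by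
    rw [topStage_link]
    change _ = T.functor.map (topMap hS hk i) ≫ x
    rw [topMap_of_lt hS hk (h.trans_le (hk j)), ← hx]
    rcases (hk j).eq_or_lt with rfl | hj
    · rw [topMap_top, Category.id_comp]
    · rw [topMap_of_lt hS hk hj, reassoc_of% hS.link_act]
  map_link_leg {i j} h := by
    change _ ≫ T.functor.map (topMap hS hk j) ≫ x = T.functor.map (topMap hS hk i) ≫ x
    rw [← T.functor.map_comp_assoc, link_topMap, topMap_of_lt hS hk (h.trans_le (hk j))]
  base_link i := by
    rw [topStage_link]
    change _ = S.base k ≫ T.unit.app (S.obj k) ≫ x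
    rcases (hk i).eq_or_lt with rfl | hi
    · rw [topMap_top, Category.id_comp]
    · rw [topMap_of_lt hS hk hi, reassoc_of% hS.base_link]

end

/-- At a limit ordinal, a chain is prolonged by its colimit. -/
theorem exists_isLimit (hT : IsConfiguration κ M T) (hα : α ≤ κ) (h : Order.IsSuccLimit α)
    (hS : S.IsChain) (hM : ∀ {i j : Set.Iio α} (h : i < j), M (S.link h)) :
    ∃ (s : S.Stage) (hs : s.IsChain), s.IsLimit hS hs ∧ ∀ i, M (s.link i) := by
  have := hT.backdrop.isMultiplicative
  have pos : 0 < α := by simpa [pos_iff_ne_zero] using h.ne_bot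
  have hF : ∀ ⦃i j : Set.Iio α⦄ (f : i ⟶ j), M ((S.toFunctor hS).map f) := fun i j f =>
    toFunctor_map_mem hS hM f
  have hcol := hT.backdrop.hasIndexedColimitsIn α pos hα
  have := hcol.hasColimit _ hF
  let c := colimit.cocone (S.toFunctor hS)
  have hc : IsColimit c := colimit.isColimit _
  obtain ⟨ι, hι⟩ : ∃ ι : ∀ i, S.obj i ⟶ c.pt, ∀ i, ι i = c.ι.app i := ⟨_, fun _ => rfl⟩
  have w : ∀ {i j : Set.Iio α} (h : i < j), S.link h ≫ ι j = ι i := fun {i j} h => by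
    rw [hι, hι]
    exact (congrArg (· ≫ c.ι.app j) (toFunctor_map hS h (homOfLE h.le)).symm).trans (c.w _)
  -- As `α` is a limit, `T Z_i` acts through the successor of `i`.
  let nxt : Set.Iio α → Set.Iio α := fun i => ⟨Order.succ i.1, h.succ_lt i.2⟩
  have lt_nxt : ∀ i, i < nxt i := fun i => Order.lt_succ i.1
  let bot : Set.Iio α := ⟨0, pos⟩
  let s : S.Stage := ⟨c.pt, S.base bot ≫ ι bot, fun i => S.act (lt_nxt i) ≫ ι (nxt i)⟩
  have hlink : ∀ i, s.link i = ι i := fun i => by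
    rw [← w (lt_nxt i), Stage.link, ActionSequence.link, Category.assoc]
  have hact : ∀ {i j : Set.Iio α} (h : i < j), S.act h ≫ ι j = s.leg i := fun {i j} h => by
    rcases (show nxt i ≤ j from Order.succ_le_of_lt (Subtype.coe_lt_coe.2 h)).eq_or_lt with rfl | hj
    · rfl
    · rw [← hS.link_act (lt_nxt i) hj, Category.assoc, w]
  have hs : s.IsChain :=
    { act_link := fun {i j} h => by rw [hlink, hact]
      map_link_leg := fun {i j} h => by
        rw [← hact (lt_nxt j), ← hact (h.trans (lt_nxt j)), ← hS.map_link_act h (lt_nxt j),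
          Category.assoc]
      base_link := fun i => by
        rw [hlink]
        rcases (show bot ≤ i from zero_le (a := i.1)).eq_or_lt with rfl | hi
        · rfl
        · rw [← hS.base_link hi, Category.assoc, w] }
  refine ⟨s, hs, ⟨h, ⟨hc.ofIsoColimit (Cocone.ext (Iso.refl _) fun i => ?_)⟩⟩, fun i => ?_⟩
  · exact (Category.comp_id _).trans ((hι i).symm.trans (hlink i).symm)
  · rw [hlink, hι]
    exact hcol.ι_mem _ hF c hc i

/-- After its last object, a chain with at least two objects is prolonged by a pushout. -/
theorem exists_succCell (hT : IsConfiguration κ M T) (hα : α ≤ κ) {k : Set.Iio α}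
    (hk : ∀ i, i ≤ k) (pos : 0 < k.1)
    (hS : S.IsChain) (hM : ∀ {i j : Set.Iio α} (h : i < j), M (S.link h)) :
    ∃ (s : S.Stage), s.IsChain ∧ Nonempty (s.SuccCell M k) ∧ ∀ i, M (s.link i) := by
  have := hT.backdrop.isMultiplicative
  have hCC := hT.backdrop.closedUnderCobaseChange
  have hcol := hT.backdrop.hasIndexedColimitsIn k.1 pos ((le_of_lt k.2).trans hα)
  have hpo : ∀ i : Set.Iio k.1, HasPushout (S.link (below_lt k i)) (T.unit.app (S.obj (below k i))) :=
    fun i => hCC.hasPushout _ _ (hM _)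
  have nat : ∀ {i j : Set.Iio α} (h : i < j), S.link h ≫ T.unit.app (S.obj j) =
      T.unit.app (S.obj i) ≫ T.functor.map (S.link h) := fun h => T.unit.naturality _
  choose P inl inr sq using fun i : Set.Iio k.1 =>
    show ∃ (P : E) (inl : S.obj k ⟶ P) (inr : T.functor.obj (S.obj (below k i)) ⟶ P),
      IsPushout (S.link (below_lt k i)) (T.unit.app (S.obj (below k i))) inl inr from
    ⟨_, _, _, @IsPushout.of_hasPushout _ _ _ _ _ _ _ (hpo i)⟩
  have hφ : ∀ {i j : Set.Iio k.1} (h : i < j), ∃ φ : P i ⟶ P j, inl i ≫ φ = inl j ∧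
      inr i ≫ φ = T.functor.map (S.link (i := below k i) (j := below k j) h) ≫ inr j := by
    intro i j h
    have w : S.link (below_lt k i) ≫ inl j = T.unit.app (S.obj (below k i)) ≫
        T.functor.map (S.link (i := below k i) (j := below k j) h) ≫ inr j := by
      rw [← reassoc_of% nat, ← (sq j).w, reassoc_of% (hS.link_link (i := below k i) (j := below k j))]
    exact ⟨(sq i).desc _ _ w, (sq i).inl_desc _ _ w, (sq i).inr_desc _ _ w⟩
  choose φ φl φr using @hφ
  -- The pushouts form a diagram in `M`, so that their colimit exists.
  have φmem : ∀ {i j : Set.Iio k.1} (h : i < j), M (φ h) := fun {i j} h => by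
    refine hT.desc_mem (f := S.link (i := below k i) (j := below k j) h) (hM _)
      (g := S.link (below_lt k j)) ?_ (sq j) _ (φl h) (φr h)
    rw [hS.link_link]
    exact sq i
  let F : Set.Iio k.1 ⥤ E := functorOfLT P φ (fun {i j l} h h' => (sq i).hom_ext
    (by rw [← Category.assoc, φl, φl, φl])
    (by rw [← Category.assoc, φr, Category.assoc, φr, φr, ← T.functor.map_comp_assoc, hS.link_link]))
  have hF : ∀ ⦃i j : Set.Iio k.1⦄ (f : i ⟶ j), M (F.map f) := fun i j f =>
    functorOfLT_map_mem M (fun h => φmem h) f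
  have := hcol.hasColimit _ hF
  let c := colimit.cocone F
  have hc : IsColimit c := colimit.isColimit _
  let ι : ∀ i, P i ⟶ c.pt := fun i => c.ι.app i
  -- A map out of the colimit of the pushouts is given by compatible maps from `Z_k` and the `T Z_i`.
  -- It is in `M` as soon as its restrictions to the pushouts are.
  have desc : ∀ {W : E} (a : S.obj k ⟶ W) (b : ∀ i, T.functor.obj (S.obj (below k i)) ⟶ W),
      (∀ i, S.link (below_lt k i) ≫ a = T.unit.app _ ≫ b i) →
      (∀ {i j : Set.Iio k.1} (h : i < j),
        T.functor.map (S.link (i := below k i) (j := below k j) h) ≫ b j = b i) →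
      ∃ d : c.pt ⟶ W, (∀ i, inl i ≫ ι i ≫ d = a) ∧ (∀ i, inr i ≫ ι i ≫ d = b i) ∧
        ((∀ l : (∀ i, P i ⟶ W), (∀ i, inl i ≫ l i = a) → (∀ i, inr i ≫ l i = b i) →
          ∀ i, M (l i)) → M d) := by
    intro W a b hab hb
    choose l hl hr using fun i => show ∃ l : P i ⟶ W, inl i ≫ l = a ∧ inr i ≫ l = b i from
      ⟨(sq i).desc _ _ (hab i), (sq i).inl_desc _ _ (hab i), (sq i).inr_desc _ _ (hab i)⟩
    have w : ∀ {i j : Set.Iio k.1} (h : i < j), φ h ≫ l j = l i := fun {i j} h =>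
      (sq i).hom_ext (by rw [reassoc_of% φl, hl, hl])
        (by rw [reassoc_of% φr, hr, hr, hb])
    let t : Cocone F := coconeOfLT F (W := W) l (fun {i j} h =>
      (congrArg (· ≫ l j) (functorOfLT_map h _)).trans (w h))
    let d : c.pt ⟶ W := hc.desc t
    have fac : ∀ i, ι i ≫ d = l i := fun i => hc.fac t i
    refine ⟨d, fun i => ?_, fun i => ?_, fun h => hcol.desc_mem F hF c hc t (h l hl hr)⟩
    · rw [fac, hl]
    · rw [fac, hr]
  obtain ⟨q, inl_q, inr_q, q_mem⟩ := desc (T.unit.app (S.obj k))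
    (fun i => T.functor.map (S.link (below_lt k i))) (fun i => nat _) (fun {i j} h => by
      rw [← T.functor.map_comp, hS.link_link])
  replace q_mem : M q := q_mem fun l hl hr i => by
    rw [(sq i).hom_ext ((hl i).trans ((sq i).inl_desc _ _ (nat _)).symm)
      ((hr i).trans ((sq i).inr_desc _ _ (nat _)).symm)]
    exact hT.leibniz_mem _ _ _ (sq i) (hM _)
  obtain ⟨p, inl_p, inr_p, -⟩ := desc (𝟙 (S.obj k)) (fun i => S.act (below_lt k i))
    (fun i => by rw [Category.comp_id, ActionSequence.link]) (fun {i j} h => hS.map_link_act _ _)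
  have := hCC.hasPushout q p q_mem
  obtain ⟨Z, x, y, hxy⟩ : ∃ (Z : E) (x : T.functor.obj (S.obj k) ⟶ Z) (y : S.obj k ⟶ Z),
    IsPushout q p x y := ⟨_, _, _, IsPushout.of_hasPushout q p⟩
  have y_mem : M y := hCC.of_isPushout hxy q_mem
  have hy : T.unit.app (S.obj k) ≫ x = y := by
    rw [← inl_q ⟨0, Set.mem_Iio.2 pos⟩, Category.assoc, Category.assoc, hxy.w, reassoc_of% inl_p]
  have hs := topStage_isChain hS hk x (fun {i} h => by
    rw [hy, ← inr_q ⟨i.1, Set.mem_Iio.2 h⟩, Category.assoc, Category.assoc, hxy.w, reassoc_of% inr_p])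
  have hlink : (topStage hS hk x).link k = y := by
    rw [Stage.link, topStage_leg_top]
    exact hy
  refine ⟨topStage hS hk x, hs, ⟨⟨hk, F, hF, c, hc, inl, inr, sq, fun _ => hM _, p, q, inl_p, inr_p,
    inl_q, inr_q, q_mem, ?_⟩⟩, fun i => ?_⟩
  · rw [topStage_leg_top, hlink]
    exact hxy
  · rcases (hk i).eq_or_lt with rfl | hi
    · rw [hlink]
      exact y_mem
    · rw [← hs.link_link hi, hlink]
      exact M.comp_mem _ _ (hM _) y_mem

end ActionSequence

end Steps

/-! ### Free algebras for pointed endofunctors -/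

section FreeAlgebras

variable {E : Type u} [Category.{v} E]

/-- The map `a : T F ⟶ F` makes `F` the free algebra on `X` for the pointed endofunctor `T`, with
`η : X ⟶ F` as universal map. -/
structure IsFreeAlgebra (T : PointedEndofunctor E) {X F : E} (η : X ⟶ F)
    (a : T.functor.obj F ⟶ F) : Prop where
  unit_act : T.unit.app F ≫ a = 𝟙 F
  existsUnique : ∀ ⦃B : E⦄ (b : T.functor.obj B ⟶ B), T.unit.app B ≫ b = 𝟙 B → ∀ f : X ⟶ B,
    ∃! h : F ⟶ B, η ≫ h = f ∧ a ≫ h = T.functor.map h ≫ b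

variable {T : PointedEndofunctor E} {X : E} {α κ : Ordinal.{w}} {M : MorphismProperty E}
  {D : Type u₁} [Category.{v₁} D] {V : E ⥤ D}

namespace ActionSequence

/-- The properties that are carried along the construction of the free algebra sequence. The two
universal properties concern the images under two functors `V₁` and `V₂`. -/
structure Stage.IsGood (M : MorphismProperty E) {D₁ : Type u₁} [Category.{v₁} D₁] (V₁ : E ⥤ D₁)
    {D₂ : Type u₂} [Category.{v₂} D₂] (V₂ : E ⥤ D₂) {S : ActionSequence T X α} (s : S.Stage) :
    Prop where
  isChain : s.IsChain
  base_mem : M s.base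
  link_mem : ∀ i, M (s.link i)
  isUniversal₁ : s.IsUniversal V₁
  isUniversal₂ : s.IsUniversal V₂
  isLimit : Order.IsSuccLimit α → ∃ (hS : S.IsChain) (hs : s.IsChain), s.IsLimit hS hs

/-- A sequence of good stages can be prolonged by a good stage. -/
theorem exists_isGood (hT : IsConfiguration κ M T) {D₁ : Type u₁} [Category.{v₁} D₁] {V₁ : E ⥤ D₁}
    {D₂ : Type u₂} [Category.{v₂} D₂] {V₂ : E ⥤ D₂} (h₁ : PreservesCells κ M V₁)
    (h₂ : PreservesCells κ M V₂) (hα : α ≤ κ) (S : ActionSequence T X α)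
    (h : ∀ j, (S.stage j).IsGood M V₁ V₂) : ∃ s : S.Stage, s.IsGood M V₁ V₂ := by
  have := hT.backdrop.isMultiplicative
  have hS : S.IsChain := isChain_of_stage fun j => (h j).isChain
  have hM : ∀ {i j : Set.Iio α} (h : i < j), M (S.link h) := fun {i j} hij =>
    (h j).link_mem ⟨i.1, Set.mem_Iio.2 hij⟩
  rcases Ordinal.zero_or_succ_or_isSuccLimit α with rfl | ⟨k, rfl⟩ | hlim
  · have hE : IsEmpty (Set.Iio (0 : Ordinal.{w})) := ⟨fun i => not_lt_zero (Set.mem_Iio.1 i.2)⟩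
    let s : S.Stage := ⟨X, 𝟙 X, fun i => hE.elim i⟩
    have : IsIso s.base := inferInstanceAs (IsIso (𝟙 X))
    exact ⟨s, ⟨fun {i} => hE.elim i, fun {i} => hE.elim i, fun i => hE.elim i⟩, M.id_mem X,
      fun i => hE.elim i, Stage.isUniversal_of_isEmpty hE, Stage.isUniversal_of_isEmpty hE,
      fun hlim => (hlim.ne_bot rfl).elim⟩
  · let k' : Set.Iio (Order.succ k) := ⟨k, Order.lt_succ k⟩
    have hk : ∀ i, i ≤ k' := fun i =>
      Subtype.coe_le_coe.1 (Order.lt_succ_iff.1 (Set.mem_Iio.1 i.2))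
    have nlim : ¬ Order.IsSuccLimit (Order.succ k) := fun h => Order.not_isSuccLimit_succ k h
    -- After `Z_0` there are no pushouts to form a colimit of; the next object is `T Z_0`.
    rcases eq_or_ne k 0 with rfl | hk0
    · have huniq : ∀ i, i = k' := fun i => le_antisymm (hk i) (zero_le (a := i.1))
      have hlt : ∀ {i j : Set.Iio (Order.succ (0 : Ordinal.{w}))}, ¬ i < j := fun {i j} hij => by
        rw [huniq i, huniq j] at hij
        exact lt_irrefl _ hij
      let s := topStage hS hk (𝟙 _)
      have hs : s.IsChain := topStage_isChain hS hk (𝟙 _) fun h => (hlt h).elim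
      have hleg : s.leg k' = 𝟙 _ := topStage_leg_top hS hk (𝟙 _)
      have : IsIso (s.leg k') := by rw [hleg]; exact inferInstanceAs (IsIso (𝟙 _))
      have hlink : ∀ i, M (s.link i) := fun i => by
        obtain rfl := huniq i
        rw [Stage.link, hleg]
        exact M.comp_mem _ _ (hT.unit_mem _) (M.id_mem _)
      refine ⟨s, hs, ?_, hlink, Stage.isUniversal_of_unique hs k' huniq,
        Stage.isUniversal_of_unique hs k' huniq, fun hlim => (nlim hlim).elim⟩
      rw [← hs.base_link k']
      exact M.comp_mem _ _ (h k').base_mem (hlink k')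
    · have pos : 0 < k := pos_iff_ne_zero.2 hk0
      obtain ⟨s, hs, ⟨hc⟩, hlink⟩ := exists_succCell hT hα hk pos hS hM
      refine ⟨s, hs, ?_, hlink, hc.isUniversal hs h₁ hα pos, hc.isUniversal hs h₂ hα pos,
        fun hlim => (nlim hlim).elim⟩
      rw [← hs.base_link k']
      exact M.comp_mem _ _ (h k').base_mem (hlink k')
  · obtain ⟨s, hs, hc, hlink⟩ := exists_isLimit hT hα hlim hS hM
    refine ⟨s, hs, ?_, hlink, hc.isUniversal h₁ hα hM, hc.isUniversal h₂ hα hM,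
      fun _ => ⟨hS, hs, hc⟩⟩
    have pos : 0 < α := by simpa [pos_iff_ne_zero] using hlim.ne_bot
    rw [← hs.base_link ⟨0, pos⟩]
    exact M.comp_mem _ _ (h _).base_mem (hlink _)

section Extension

variable {S : ActionSequence T X α} {T' : PointedEndofunctor D}
  (ψ : ∀ i, V.obj (T.functor.obj (S.obj i)) ⟶ T'.functor.obj (V.obj (S.obj i)))
  {B : D} (b : T'.functor.obj B ⟶ B) (f : V.obj X ⟶ B)

/-- A map `V Z_j ⟶ B` to an algebra for `T'` which is compatible with the partial actions. -/
structure IsExtension (j : Set.Iio α) (h : V.obj (S.obj j) ⟶ B) : Prop where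
  base : V.map (S.base j) ≫ h = f
  act : ∀ {i} (hij : i < j),
    V.map (S.act hij) ≫ h = ψ i ≫ T'.functor.map (V.map (S.link hij) ≫ h) ≫ b

variable {ψ b f}

theorem IsExtension.link (hS : S.IsChain) {i j : Set.Iio α} (hij : i < j)
    {h : V.obj (S.obj j) ⟶ B} (hh : S.IsExtension ψ b f j h) :
    S.IsExtension ψ b f i (V.map (S.link hij) ≫ h) where
  base := by rw [← V.map_comp_assoc, hS.base_link, hh.base]
  act {l} hl := by
    rw [← V.map_comp_assoc, hS.link_act, hh.act, ← V.map_comp_assoc, hS.link_link]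

/-- A map to an algebra under `X` extends uniquely to each member of the free algebra sequence. -/
theorem existsUnique_isExtension (hS : S.IsChain) (hU : ∀ j, (S.stage j).IsUniversal V)
    (ψ_link : ∀ {i j : Set.Iio α} (h : i < j), V.map (T.functor.map (S.link h)) ≫ ψ j =
      ψ i ≫ T'.functor.map (V.map (S.link h)))
    (unit_ψ : ∀ i, V.map (T.unit.app (S.obj i)) ≫ ψ i = T'.unit.app (V.obj (S.obj i)))
    (hb : T'.unit.app B ≫ b = 𝟙 B) (j : Set.Iio α) : ∃! h, S.IsExtension ψ b f j h := by
  induction j using WellFoundedLT.induction with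
  | ind j ih =>
    choose g hg hg' using ih
    have nat : ∀ {i : Set.Iio α} (h : V.obj (S.obj i) ⟶ B),
        V.map (T.unit.app (S.obj i)) ≫ ψ i ≫ T'.functor.map h ≫ b = h := fun {i} h => by
      have := T'.unit.naturality h
      dsimp at this
      rw [reassoc_of% unit_ψ, ← reassoc_of% this, hb, Category.comp_id]
    have g_link : ∀ {i k} (hik : i < k) (hk : k < j),
        V.map (S.link hik) ≫ g k hk = g i (hik.trans hk) := fun {i k} hik hk =>
      hg' _ (hik.trans hk) _ ((hg k hk).link hS hik)
    -- The family to which the universal property applies consists of the values that the actions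
    -- dictate, given the extensions `g` to the earlier members.
    obtain ⟨d, hd, act, uniq⟩ : ∃ d : V.obj (S.obj j) ⟶ B, V.map (S.base j) ≫ d = f ∧
        (∀ {i} (hi : i < j), V.map (S.act hi) ≫ d = ψ i ≫ T'.functor.map (g i hi) ≫ b) ∧
        ∀ d' : V.obj (S.obj j) ⟶ B, V.map (S.base j) ≫ d' = f →
          (∀ {i} (hi : i < j), V.map (S.act hi) ≫ d' = ψ i ≫ T'.functor.map (g i hi) ≫ b) →
          d' = d := by
      obtain ⟨d, ⟨hd, hd'⟩, uniq⟩ := hU j f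
        (fun i => ψ (below j i) ≫ T'.functor.map (g (below j i) (below_lt j i)) ≫ b)
        { act := fun {i k} hik => by
            refine (congrArg _ (nat _)).trans ?_
            refine ((hg (below j k) (below_lt j k)).act (i := below j i) hik).trans ?_
            rw [g_link (i := below j i) (k := below j k) hik (below_lt j k)]
            rfl
          map_link := fun {i k} hik => by
            have := ψ_link (i := below j i) (j := below j k) hik
            refine ((reassoc_of% this) _).trans ?_
            rw [← T'.functor.map_comp_assoc,
              g_link (i := below j i) (k := below j k) hik (below_lt j k)]
            rfl
          base := fun i => (congrArg _ (nat _)).trans (hg _ _).base }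
      exact ⟨d, hd, fun {i} hi => hd' ⟨i.1, hi⟩, fun d' h h' => uniq d' ⟨h, fun i => h' _⟩⟩
    refine ⟨d, ⟨hd, fun {i} hi => ?_⟩, fun d' h' => uniq d' h'.base fun {i} hi => ?_⟩
    · have : V.map (S.link hi) ≫ d = g i hi := by
        rw [ActionSequence.link, V.map_comp, Category.assoc, act, nat]
      rw [act, this]
    · rw [← hg' _ _ _ (h'.link hS hi)]
      exact h'.act hi

end Extension

end ActionSequence

open ActionSequence

/-- The stage at a limit ordinal whose colimits are preserved by `T` is an algebra. -/
theorem ActionSequence.Stage.IsLimit.exists_act {S : ActionSequence T X α} {s : S.Stage}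
    {hS : S.IsChain} {hs : s.IsChain} (h : s.IsLimit hS hs)
    [PreservesColimit (S.toFunctor hS) T.functor] :
    ∃ a : T.functor.obj s.pt ⟶ s.pt, (∀ i, T.functor.map (s.link i) ≫ a = s.leg i) ∧
      T.unit.app s.pt ≫ a = 𝟙 _ := by
  obtain ⟨hc⟩ := h.isColimit
  have hc' := isColimitOfPreserves T.functor hc
  let t : Cocone (S.toFunctor hS ⋙ T.functor) := coconeOfLT _ (W := s.pt) s.leg (fun {i j} h =>
    (congrArg (fun f => T.functor.map f ≫ s.leg j) (toFunctor_map hS h _)).trans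
      (hs.map_link_leg h))
  let a : T.functor.obj s.pt ⟶ s.pt := hc'.desc t
  have ha : ∀ i, T.functor.map (s.link i) ≫ a = s.leg i := fun i => hc'.fac t i
  refine ⟨a, ha, hc.hom_ext fun i => ?_⟩
  change s.link i ≫ _ = s.link i ≫ _
  have nat : s.link i ≫ T.unit.app s.pt = T.unit.app (S.obj i) ≫ T.functor.map (s.link i) :=
    T.unit.naturality _
  rw [reassoc_of% nat, ha]
  exact (Category.comp_id _).symm

/-- As `V T` preserves the colimit, maps out of `V T` of it are determined on the members. -/
theorem ActionSequence.Stage.IsLimit.hom_ext_map {S : ActionSequence T X α} {s : S.Stage}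
    {hS : S.IsChain} {hs : s.IsChain} (h : s.IsLimit hS hs)
    [PreservesColimit (S.toFunctor hS) T.functor]
    [PreservesColimit (S.toFunctor hS ⋙ T.functor) V] {W : D}
    {f g : V.obj (T.functor.obj s.pt) ⟶ W}
    (hfg : ∀ i, V.map (T.functor.map (s.link i)) ≫ f = V.map (T.functor.map (s.link i)) ≫ g) :
    f = g := by
  obtain ⟨hc⟩ := h.isColimit
  exact (isColimitOfPreserves V (isColimitOfPreserves T.functor hc)).hom_ext hfg

/-- A family of maps `V T G ⟶ T' V G`, natural in the objects `G` under `X` through a map in `M`, and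
compatible with the units. -/
structure PartialTransformation (M : MorphismProperty E) (T : PointedEndofunctor E) (X : E)
    (V : E ⥤ D) (T' : PointedEndofunctor D) where
  app : ∀ {G : E} (x : X ⟶ G), M x → (V.obj (T.functor.obj G) ⟶ T'.functor.obj (V.obj G))
  naturality : ∀ {G G' : E} {x : X ⟶ G} {x' : X ⟶ G'} (hx : M x) (hx' : M x') (m : G ⟶ G'),
    x ≫ m = x' → V.map (T.functor.map m) ≫ app x' hx' = app x hx ≫ T'.functor.map (V.map m)
  unit_app : ∀ {G : E} {x : X ⟶ G} (hx : M x),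
    V.map (T.unit.app G) ≫ app x hx = T'.unit.app (V.obj G)

/-- The image under `V` of `η : X ⟶ F` and `a : T F ⟶ F` has the universal property of the free
algebra on `V X` for `T'`, where the action of `T'` on `V F` is understood through a partial
transformation `V T ⟶ T' V`. -/
def IsFreeAlong (M : MorphismProperty E) (T : PointedEndofunctor E) (V : E ⥤ D) {X F : E}
    (η : X ⟶ F) (a : T.functor.obj F ⟶ F) : Prop :=
  ∀ (T' : PointedEndofunctor D) (ψ : PartialTransformation M T X V T') (hη : M η) (B : D)
    (b : T'.functor.obj B ⟶ B), T'.unit.app B ≫ b = 𝟙 B → ∀ f : V.obj X ⟶ B,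
      ∃! h : V.obj F ⟶ B, V.map η ≫ h = f ∧ V.map a ≫ h = ψ.app η hη ≫ T'.functor.map h ≫ b

/-- The member of index `κ` of the free algebra sequence is free along `V`. -/
theorem isFreeAlong_of_isGood (hT : IsConfiguration κ M T) (hκ : Order.IsSuccLimit κ)
    (hV : PreservesCells κ M V) (S : ActionSequence T X (Order.succ κ)) (hS : S.IsChain)
    (base_mem : ∀ i, M (S.base i))
    (link_mem : ∀ {i j : Set.Iio (Order.succ κ)} (h : i < j), M (S.link h))
    (hU : ∀ j, (S.stage j).IsUniversal V)
    (top : Set.Iio (Order.succ κ)) (htop : top.1 = κ)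
    (hlim : ∃ (hS : _) (hs : _), (S.stage top).IsLimit hS hs)
    (a : T.functor.obj (S.obj top) ⟶ S.obj top)
    (ha : ∀ {i} (h : i < top), T.functor.map (S.link h) ≫ a = S.act h) :
    IsFreeAlong M T V (S.base top) a := by
  have := hT.backdrop.isMultiplicative
  obtain ⟨top, h⟩ := top
  obtain rfl : top = κ := htop
  intro T' ψ hη B b hb f
  obtain ⟨hS', hs, hlim⟩ := hlim
  have hF : ∀ ⦃i j : Set.Iio top⦄ (f : i ⟶ j), M (((S.restrict h.le).toFunctor hS').map f) :=
    fun i j f => toFunctor_map_mem (S := S.restrict h.le) hS' (fun hij => link_mem hij) f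
  have pos : 0 < top := by simpa [pos_iff_ne_zero] using hκ.ne_bot
  have := hT.convergence _ hF
  have := hV.preservesColimit top pos le_rfl (((S.restrict h.le).toFunctor hS') ⋙ T.functor)
    (fun i j f => hT.map_mem _ (hF f))
  have nat := fun {i : Set.Iio (Order.succ top)} (h : i < ⟨top, h⟩) =>
    ψ.naturality (base_mem i) hη (S.link h) (hS.base_link h)
  -- For maps out of `V Z_κ`, compatibility with the partial actions is compatibility with `a`, since
  -- `V T` preserves the colimit `Z_κ`.
  have key : ∀ h', S.IsExtension (fun i => ψ.app (S.base i) (base_mem i)) b f ⟨top, h⟩ h' ↔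
      V.map (S.base ⟨top, h⟩) ≫ h' = f ∧
        V.map a ≫ h' = ψ.app (S.base ⟨top, h⟩) hη ≫ T'.functor.map h' ≫ b := by
    intro h'
    refine ⟨fun hh => ⟨hh.base, hlim.hom_ext_map (V := V) fun i => ?_⟩, fun hh => ⟨hh.1, fun {i} hi => ?_⟩⟩
    · have hi : below ⟨top, h⟩ i < ⟨top, h⟩ := below_lt ⟨top, h⟩ i
      change V.map (T.functor.map (S.link hi)) ≫ _ = V.map (T.functor.map (S.link hi)) ≫ _
      rw [← V.map_comp_assoc, ha, hh.act, reassoc_of% (nat hi), T'.functor.map_comp_assoc]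
    · rw [← ha hi, V.map_comp, Category.assoc, hh.2, reassoc_of% (nat hi),
        T'.functor.map_comp_assoc]
  simp only [← key]
  exact existsUnique_isExtension hS hU
    (fun {i j} hij => ψ.naturality (base_mem i) (base_mem j) _ (hS.base_link hij))
    (fun i => ψ.unit_app (base_mem i)) hb ⟨top, h⟩

/-- In a configuration, free algebras exist; the universal property of the free algebra that is
constructed also holds in the image of a functor preserving the colimits used. -/
theorem IsConfiguration.exists_isFreeAlong (hT : IsConfiguration κ M T) (hκ : Order.IsSuccLimit κ)
    {D₁ : Type u₁} [Category.{v₁} D₁] {V₁ : E ⥤ D₁}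
    {D₂ : Type u₂} [Category.{v₂} D₂] {V₂ : E ⥤ D₂} (h₁ : PreservesCells κ M V₁)
    (h₂ : PreservesCells κ M V₂) (X : E) :
    ∃ (F : E) (η : X ⟶ F) (a : T.functor.obj F ⟶ F), M η ∧ T.unit.app F ≫ a = 𝟙 F ∧
      IsFreeAlong M T V₁ η a ∧ IsFreeAlong M T V₂ η a := by
  have := hT.backdrop.isMultiplicative
  obtain ⟨S, h⟩ := exists_actionSequence (κ := Order.succ κ) (T := T) (X := X)
    (fun _ s => s.IsGood M V₁ V₂) fun α hα S h =>
      exists_isGood hT h₁ h₂ (Order.lt_succ_iff.1 hα) S h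
  have hS : S.IsChain := isChain_of_stage fun j => (h j).isChain
  have hM : ∀ {i j : Set.Iio (Order.succ κ)} (h : i < j), M (S.link h) := fun {i j} hij =>
    (h j).link_mem ⟨i.1, Set.mem_Iio.2 hij⟩
  let top : Set.Iio (Order.succ κ) := ⟨κ, Order.lt_succ κ⟩
  have hlim := (h top).isLimit hκ
  obtain ⟨hS', hs, hc⟩ := id hlim
  have := hT.convergence ((S.restrict (Order.le_succ κ)).toFunctor hS') fun i j f =>
    toFunctor_map_mem (S := S.restrict (Order.le_succ κ)) hS' (fun hij => hM hij) f
  obtain ⟨a, ha, ha'⟩ := hc.exists_act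
  have ha : ∀ {i} (h : i < top), T.functor.map (S.link h) ≫ a = S.act h := fun {i} h =>
    ha ⟨i.1, Set.mem_Iio.2 h⟩
  exact ⟨S.obj top, S.base top, a, (h top).base_mem, ha',
    isFreeAlong_of_isGood hT hκ h₁ S hS (fun i => (h i).base_mem) hM (fun j => (h j).isUniversal₁)
      top rfl hlim a ha,
    isFreeAlong_of_isGood hT hκ h₂ S hS (fun i => (h i).base_mem) hM (fun j => (h j).isUniversal₂)
      top rfl hlim a ha⟩

theorem IsFreeAlong.isFreeAlgebra {F : E} {η : X ⟶ F} {a : T.functor.obj F ⟶ F} (hη : M η)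
    (ha : T.unit.app F ≫ a = 𝟙 F) (h : IsFreeAlong M T (𝟭 E) η a) : IsFreeAlgebra T η a where
  unit_act := ha
  existsUnique B b hb f := by
    simpa using h T ⟨fun _ _ => 𝟙 _, fun _ _ _ _ => by simp, fun _ => by simp⟩ hη B b hb f

theorem IsConfiguration.exists_isFreeAlgebra (hT : IsConfiguration κ M T)
    (hκ : Order.IsSuccLimit κ) (X : E) :
    ∃ (F : E) (η : X ⟶ F) (a : T.functor.obj F ⟶ F), IsFreeAlgebra T η a := by
  obtain ⟨F, η, a, hη, ha, h, -⟩ :=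
    hT.exists_isFreeAlong hκ (PreservesCells.id κ M) (PreservesCells.id κ M) X
  exact ⟨F, η, a, h.isFreeAlgebra hη ha⟩

end FreeAlgebras

/-! ### The monad of free algebras -/

section FreeMonad

variable {C : Type u} [Category.{v} C] {T : PointedEndofunctor C}

namespace IsFreeAlgebra

variable {X F : C} {η : X ⟶ F} {a : T.functor.obj F ⟶ F}

theorem hom_ext (h : IsFreeAlgebra T η a) {B : C} (b : T.functor.obj B ⟶ B)
    (hb : T.unit.app B ≫ b = 𝟙 B) {f g : F ⟶ B} (e : η ≫ f = η ≫ g)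
    (hf : a ≫ f = T.functor.map f ≫ b) (hg : a ≫ g = T.functor.map g ≫ b) : f = g :=
  (h.existsUnique b hb (η ≫ g)).unique ⟨e, hf⟩ ⟨rfl, hg⟩

theorem of_iso (h : IsFreeAlgebra T η a) {F' : C} (e : F ≅ F') {η' : X ⟶ F'}
    {a' : T.functor.obj F' ⟶ F'} (hη : η ≫ e.hom = η')
    (ha : a ≫ e.hom = T.functor.map e.hom ≫ a') : IsFreeAlgebra T η' a' := by
  have ha' : a' = T.functor.map e.inv ≫ a ≫ e.hom := by
    rw [ha, ← T.functor.map_comp_assoc]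
    simp
  subst hη
  constructor
  · have nat := T.unit.naturality e.inv
    dsimp at nat
    rw [ha', ← reassoc_of% nat, reassoc_of% h.unit_act, e.inv_hom_id]
  · intro B b hb f
    obtain ⟨g, ⟨hg₁, hg₂⟩, hg⟩ := h.existsUnique b hb f
    refine ⟨e.inv ≫ g, ⟨by simpa using hg₁, ?_⟩, fun g' hg' => ?_⟩
    · simp [ha', hg₂]
    · rw [e.eq_inv_comp]
      exact hg _ ⟨by simpa using hg'.1, by rw [reassoc_of% ha, hg'.2, T.functor.map_comp_assoc]⟩

end IsFreeAlgebra

variable (T) in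
/-- A choice of free algebras for a pointed endofunctor. -/
structure FreeAlgebras where
  obj : C → C
  η : ∀ X, X ⟶ obj X
  act : ∀ X, T.functor.obj (obj X) ⟶ obj X
  isFree : ∀ X, IsFreeAlgebra T (η X) (act X)

namespace FreeAlgebras

variable (L : FreeAlgebras T)

section

variable {X B : C} (f : X ⟶ B) (b : T.functor.obj B ⟶ B) (hb : T.unit.app B ≫ b = 𝟙 B)

/-- The map of algebras out of a free algebra that is determined by a map out of its generators. -/
noncomputable def desc : L.obj X ⟶ B :=
  ((L.isFree X).existsUnique b hb f).choose

@[simp]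
theorem η_desc : L.η X ≫ L.desc f b hb = f :=
  ((L.isFree X).existsUnique b hb f).choose_spec.1.1

theorem act_desc : L.act X ≫ L.desc f b hb = T.functor.map (L.desc f b hb) ≫ b :=
  ((L.isFree X).existsUnique b hb f).choose_spec.1.2

end

@[simp]
theorem unit_act (X : C) : T.unit.app (L.obj X) ≫ L.act X = 𝟙 _ :=
  (L.isFree X).unit_act

/-- The action of the free algebra functor on maps. -/
noncomputable def map {X Y : C} (f : X ⟶ Y) : L.obj X ⟶ L.obj Y :=
  L.desc (f ≫ L.η Y) (L.act Y) (L.unit_act Y)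

@[simp]
theorem η_map {X Y : C} (f : X ⟶ Y) : L.η X ≫ L.map f = f ≫ L.η Y :=
  L.η_desc _ _ _

@[simp]
theorem η_map_assoc {X Y Z : C} (f : X ⟶ Y) (h : L.obj Y ⟶ Z) :
    L.η X ≫ L.map f ≫ h = f ≫ L.η Y ≫ h := by
  rw [← Category.assoc, η_map, Category.assoc]

theorem act_map {X Y : C} (f : X ⟶ Y) : L.act X ≫ L.map f = T.functor.map (L.map f) ≫ L.act Y :=
  L.act_desc _ _ _

/-- The multiplication of the monad of free algebras. -/
noncomputable def μ (X : C) : L.obj (L.obj X) ⟶ L.obj X :=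
  L.desc (𝟙 _) (L.act X) (L.unit_act X)

@[simp]
theorem η_μ (X : C) : L.η (L.obj X) ≫ L.μ X = 𝟙 _ :=
  L.η_desc _ _ _

@[simp]
theorem η_μ_assoc {X Z : C} (h : L.obj X ⟶ Z) : L.η (L.obj X) ≫ L.μ X ≫ h = h := by
  rw [← Category.assoc, η_μ, Category.id_comp]

theorem act_μ (X : C) : L.act (L.obj X) ≫ L.μ X = T.functor.map (L.μ X) ≫ L.act X :=
  L.act_desc _ _ _

variable {L} in
theorem hom_ext {X B : C} (b : T.functor.obj B ⟶ B) (hb : T.unit.app B ≫ b = 𝟙 B)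
    {f g : L.obj X ⟶ B} (e : L.η X ≫ f = L.η X ≫ g) (hf : L.act X ≫ f = T.functor.map f ≫ b)
    (hg : L.act X ≫ g = T.functor.map g ≫ b) : f = g :=
  (L.isFree X).hom_ext b hb e hf hg

theorem map_id (X : C) : L.map (𝟙 X) = 𝟙 (L.obj X) :=
  hom_ext (L.act X) (L.unit_act X) (by simp) (L.act_map _) (by simp)

theorem map_comp {X Y Z : C} (f : X ⟶ Y) (g : Y ⟶ Z) : L.map (f ≫ g) = L.map f ≫ L.map g :=
  hom_ext (L.act Z) (L.unit_act Z) (by simp) (L.act_map _) (by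
    rw [reassoc_of% L.act_map, act_map, T.functor.map_comp_assoc])

/-- The free algebra functor. -/
noncomputable def functor : C ⥤ C where
  obj := L.obj
  map := L.map
  map_id := L.map_id
  map_comp := L.map_comp

theorem map_μ {X Y : C} (f : X ⟶ Y) : L.map (L.map f) ≫ L.μ Y = L.μ X ≫ L.map f :=
  hom_ext (L.act Y) (L.unit_act Y) (by simp)
    (by rw [reassoc_of% L.act_map, act_μ, T.functor.map_comp_assoc])
    (by rw [reassoc_of% L.act_μ, act_map, T.functor.map_comp_assoc])

theorem map_η_μ (X : C) : L.map (L.η X) ≫ L.μ X = 𝟙 _ :=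
  hom_ext (L.act X) (L.unit_act X) (by simp)
    (by rw [reassoc_of% L.act_map, act_μ, T.functor.map_comp_assoc]) (by simp)

theorem μ_assoc (X : C) : L.map (L.μ X) ≫ L.μ X = L.μ (L.obj X) ≫ L.μ X :=
  hom_ext (L.act X) (L.unit_act X) (by simp)
    (by rw [reassoc_of% L.act_map, act_μ, T.functor.map_comp_assoc])
    (by rw [reassoc_of% L.act_μ, act_μ, T.functor.map_comp_assoc])

/-- The monad of free algebras. -/
noncomputable def monad : Monad C where
  toFunctor := L.functor
  η := { app := L.η, naturality := fun _ _ f => (L.η_map f).symm }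
  μ := { app := L.μ, naturality := fun _ _ f => L.map_μ f }
  assoc := L.μ_assoc
  left_unit := L.η_μ
  right_unit := L.map_η_μ

/-- The component at `X` of the universal map from `T` to the monad of free algebras. -/
noncomputable def ι (X : C) : T.functor.obj X ⟶ L.obj X :=
  T.functor.map (L.η X) ≫ L.act X

theorem map_ι {X Y : C} (f : X ⟶ Y) : T.functor.map f ≫ L.ι Y = L.ι X ≫ L.map f := by
  rw [ι, ι, Category.assoc, act_map, ← T.functor.map_comp_assoc, ← T.functor.map_comp_assoc, η_map]

theorem unit_ι (X : C) : T.unit.app X ≫ L.ι X = L.η X := by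
  have nat := T.unit.naturality (L.η X)
  dsimp at nat
  rw [ι, ← reassoc_of% nat, unit_act]
  exact Category.comp_id _

theorem ι_μ (X : C) : L.ι (L.obj X) ≫ L.μ X = L.act X := by
  rw [ι, Category.assoc, act_μ, ← T.functor.map_comp_assoc, η_μ]
  simp

/-- The universal map from `T` to the monad of free algebras. -/
noncomputable def toMonad : T ⟶ underPtd L.monad :=
  PointedEndofunctor.Hom.mk { app := L.ι, naturality := fun _ _ f => L.map_ι f }
    (by ext X; exact L.unit_ι X)

end FreeAlgebras

section

variable {M M' : Monad C}

/-- The component at `X` of a morphism from `T` to the underlying pointed endofunctor of a monad. -/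
def natApp (γ : T ⟶ underPtd M) (X : C) : T.functor.obj X ⟶ M.obj X :=
  γ.nat.app X

/-- The algebra structure for `T` on a free algebra of a monad `M` that is induced by a morphism
`γ : T ⟶ M`. -/
def freeAct (γ : T ⟶ underPtd M) (X : C) : T.functor.obj (M.obj X) ⟶ M.obj X :=
  natApp γ (M.obj X) ≫ M.μ.app X

variable (γ : T ⟶ underPtd M)

theorem unit_natApp (X : C) : T.unit.app X ≫ natApp γ X = M.η.app X :=
  congrArg (fun t => t.app X) γ.unit_nat

theorem map_natApp {X Y : C} (f : X ⟶ Y) :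
    T.functor.map f ≫ natApp γ Y = natApp γ X ≫ M.map f :=
  γ.nat.naturality f

theorem natApp_comp (α : M ⟶ M') (X : C) :
    natApp (γ ≫ underPtdMap α) X = natApp γ X ≫ α.app X :=
  rfl

@[simp]
theorem unit_freeAct (X : C) : T.unit.app (M.obj X) ≫ freeAct γ X = 𝟙 (M.obj X) := by
  rw [freeAct, reassoc_of% (unit_natApp γ (M.obj X)), M.left_unit]
  rfl

theorem freeAct_map {X Y : C} (f : X ⟶ Y) :
    freeAct γ X ≫ M.map f = T.functor.map (M.map f) ≫ freeAct γ Y := by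
  rw [freeAct, freeAct, reassoc_of% map_natApp, M.mu_naturality, Category.assoc]

theorem freeAct_μ (X : C) :
    freeAct γ (M.obj X) ≫ M.μ.app X = T.functor.map (M.μ.app X) ≫ freeAct γ X := by
  have := map_natApp γ (M.μ.app X)
  dsimp at this
  rw [freeAct, freeAct, reassoc_of% this, M.assoc, Category.assoc]

theorem map_η_freeAct (X : C) : T.functor.map (M.η.app X) ≫ freeAct γ X = natApp γ X := by
  have := map_natApp γ (M.η.app X)
  dsimp at this
  rw [freeAct, reassoc_of% this, M.right_unit]
  exact Category.comp_id _

theorem freeAct_hom (α : M ⟶ M') (X : C) : freeAct γ X ≫ α.app X =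
    T.functor.map (α.app X) ≫ freeAct (γ ≫ underPtdMap α) X := by
  rw [freeAct, freeAct, natApp_comp, Category.assoc, Category.assoc, α.app_μ,
    reassoc_of% map_natApp, Category.assoc]

/-- A monad whose underlying endofunctor consists of free algebras for `T` is the free monad on
`T`. -/
theorem isFreeMonad_of_isFreeAlgebra (h : ∀ X, IsFreeAlgebra T (M.η.app X) (freeAct γ X)) :
    IsFreeMonad γ := by
  intro M' δ
  choose α hα hα' using fun X => ((h X).existsUnique (freeAct δ X) (unit_freeAct δ X)
    (M'.η.app X)).exists
  have nat : ∀ {X Y : C} (f : X ⟶ Y), M.map f ≫ α Y = α X ≫ M'.map f := fun {X Y} f => by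
    refine (h X).hom_ext (freeAct δ Y) (unit_freeAct δ Y) ?_ ?_ ?_
    · have h₁ := M.η.naturality f
      have h₂ := M'.η.naturality f
      dsimp at h₁ h₂
      rw [← reassoc_of% h₁, hα, reassoc_of% (hα X), h₂]
    · rw [reassoc_of% @freeAct_map, hα', T.functor.map_comp_assoc]
    · rw [reassoc_of% hα', freeAct_map, T.functor.map_comp_assoc]
  let α' : M ⟶ M' :=
    { app := α
      naturality := fun _ _ f => nat f
      app_η := hα
      app_μ := fun X => by
        refine (h _).hom_ext (freeAct δ X) (unit_freeAct δ X) ?_ ?_ ?_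
        · have := M'.η.naturality (α X)
          dsimp at this
          rw [reassoc_of% @Monad.left_unit, nat, Category.assoc, reassoc_of% (hα (M.obj X)),
            ← reassoc_of% this, M'.left_unit]
          exact (Category.comp_id _).symm
        · rw [reassoc_of% @freeAct_μ, hα', T.functor.map_comp_assoc]
        · rw [Category.assoc, reassoc_of% @freeAct_map, reassoc_of% hα', freeAct_μ]
          simp }
  refine ⟨α', ?_, fun β hβ => ?_⟩
  · apply PointedEndofunctor.Hom.ext
    ext X
    change natApp γ X ≫ α X = natApp δ X
    rw [← map_η_freeAct, Category.assoc, hα', ← T.functor.map_comp_assoc, hα, map_η_freeAct]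
  · ext X
    refine (h X).hom_ext (freeAct δ X) (unit_freeAct δ X) ?_ ?_ (hα' X)
    · exact (β.app_η X).trans (hα X).symm
    · rw [← hβ]
      exact freeAct_hom γ β X

end

theorem FreeAlgebras.freeAct_toMonad (L : FreeAlgebras T) (X : C) :
    freeAct L.toMonad X = L.act X :=
  L.ι_μ X

theorem FreeAlgebras.isFreeMonad (L : FreeAlgebras T) : IsFreeMonad L.toMonad :=
  isFreeMonad_of_isFreeAlgebra _ fun X => by
    rw [L.freeAct_toMonad]
    exact L.isFree X

/-- If free algebras exist, then every free monad consists of free algebras. -/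
theorem IsFreeMonad.isFreeAlgebra {M : Monad C} {γ : T ⟶ underPtd M} (hγ : IsFreeMonad γ)
    (L : FreeAlgebras T) (X : C) : IsFreeAlgebra T (M.η.app X) (freeAct γ X) := by
  obtain ⟨α, hα, -⟩ := L.isFreeMonad M γ
  obtain ⟨β, hβ, -⟩ := hγ L.monad L.toMonad
  have assoc : ∀ {M₁ M₂ M₃ : Monad C} (δ : T ⟶ underPtd M₁) (f : M₁ ⟶ M₂) (g : M₂ ⟶ M₃),
      δ ≫ underPtdMap (f ≫ g) = (δ ≫ underPtdMap f) ≫ underPtdMap g := fun δ f g =>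
    (Category.assoc δ (underPtdMap f) (underPtdMap g)).symm
  have id_comp : ∀ {M₁ : Monad C} (δ : T ⟶ underPtd M₁), δ ≫ underPtdMap (𝟙 M₁) = δ := fun δ =>
    Category.comp_id δ
  have h₁ : α ≫ β = 𝟙 _ := (L.isFreeMonad _ _).unique (by rw [assoc, hα, hβ]) (id_comp _)
  have h₂ : β ≫ α = 𝟙 _ := (hγ _ _).unique (by rw [assoc, hβ, hα]) (id_comp _)
  let e : L.obj X ≅ M.obj X := ⟨α.app X, β.app X, congrArg (fun t => t.app X) h₁,
    congrArg (fun t => t.app X) h₂⟩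
  refine (L.isFree X).of_iso e (α.app_η X) ?_
  rw [← hα, ← L.freeAct_toMonad]
  exact freeAct_hom L.toMonad α X

end FreeMonad

/-! ### The configuration of vertical morphisms -/

section ArrowColimits

variable {E : Type u} [Category.{v} E]

/-- The codomain functor `Arrow E ⥤ E` is left adjoint to the functor sending an object to its
identity; hence it preserves all colimits. -/
def arrowRightAdjunction :
    (Arrow.rightFunc : Arrow E ⥤ E) ⊣
      { obj := fun W => Arrow.mk (𝟙 W), map := fun f => Arrow.homMk f f } :=
  Adjunction.mkOfUnitCounit
    { unit :=
        { app := fun Y => Arrow.homMk Y.hom (𝟙 _)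
          naturality := fun X Y f => by
            ext
            · exact f.w
            · exact (Category.comp_id f.right).trans (Category.id_comp f.right).symm }
      counit :=
        { app := fun W => 𝟙 W
          naturality := fun X Y f => (Category.comp_id f).trans (Category.id_comp f).symm }
      left_triangle := by
        ext Y
        exact (congrArg (𝟙 _ ≫ ·) (Category.id_comp _)).trans (Category.id_comp _)
      right_triangle := by
        ext W
        · exact (congrArg (𝟙 _ ≫ ·) (Category.id_comp _)).trans (Category.id_comp _)
        · exact (congrArg (𝟙 _ ≫ ·) (Category.id_comp _)).trans (Category.id_comp _) }

instance : (Arrow.rightFunc : Arrow E ⥤ E).IsLeftAdjoint :=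
  arrowRightAdjunction.isLeftAdjoint

end ArrowColimits

section VerticalConfiguration

variable {E : Type u} [Category.{v} E] {A : PseudoDoubleCategory.{v, u, v', u'} E}
  {κ : Ordinal.{w}} {M : MorphismProperty E} {T : PointedEndofunctor E}

variable (A) in
/-- The vertical codomain functor. -/
def codFunctor : A.VertArr ⥤ E where
  obj f := f.tgt
  map β := A.cmap β
  map_id f := A.cmap_id f
  map_comp β γ := A.cmap_comp β γ

theorem NotionOfComposableStructure.isIso_of_isIso (U : NotionOfComposableStructure A)
    {f g : A.VertArr} (β : f ⟶ g) (h : IsIso (A.dmap β)) (h' : IsIso (A.cmap β)) : IsIso β := by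
  have := U.conservative
  have h₁ : IsIso (U.vert.map β).left := h
  have h₂ : IsIso (U.vert.map β).right := h'
  have : IsIso (U.vert.map β) := Arrow.isIso_of_isIso_left_of_isIso_right _
  exact isIso_of_reflects_iso β U.vert

theorem codClass_isMultiplicative [M.IsMultiplicative] : (codClass A M).IsMultiplicative where
  id_mem f := ⟨by rw [A.dmap_id]; infer_instance, by rw [A.cmap_id]; exact M.id_mem _⟩
  comp_mem β γ hβ hγ := by
    have := hβ.1
    have := hγ.1
    exact ⟨by rw [A.dmap_comp]; infer_instance, by rw [A.cmap_comp]; exact M.comp_mem _ _ hβ.2 hγ.2⟩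

/-- The vertical codomain functor is the composite of `U` and the codomain functor on arrows, which
preserves all colimits. -/
theorem NotionOfComposableStructure.IsCellular.preservesCells {U : NotionOfComposableStructure A}
    (hU : U.IsCellular κ M) : PreservesCells κ (codClass A M) (codFunctor A) where
  isPushout f g h k β γ inl inr sq hβ := by
    have := hU.preserves_pushouts β γ hβ
    exact (sq.map U.vert).map Arrow.rightFunc
  preservesColimit α h0 hα F hF := by
    have := hU.preserves_indexedColimits α h0 hα F hF
    exact inferInstanceAs (PreservesColimit F (U.vert ⋙ Arrow.rightFunc))

/-- The pointed endofunctor on vertical morphisms underlying an `A`-point. -/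
def Point.pointed (P : Point A T) : PointedEndofunctor A.VertArr := ⟨P.lift.functor, P.unit⟩

/-- Vertical morphisms and squares, with the class of squares that are invertible on domains and in
`M` on codomains, and with the pointed endofunctor of an `A`-point, form a configuration. -/
theorem IsConfiguration.vertical (hT : IsConfiguration κ M T) (hκ : Order.IsSuccLimit κ)
    {U : NotionOfComposableStructure A} (hU : U.IsCellular κ M) (P : Point A T) :
    IsConfiguration κ (codClass A M) P.pointed := by
  have := hT.backdrop.isMultiplicative
  have pos : 0 < κ := by simpa [pos_iff_ne_zero] using hκ.ne_bot
  have unit_mem : ∀ f : A.VertArr, codClass A M (P.unit.app f) := fun f =>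
    ⟨by rw [P.dmap_unit]; exact inferInstanceAs (IsIso (𝟙 f.src)),
      by rw [P.cmap_unit]; exact hT.unit_mem _⟩
  have map_mem : ∀ {f g : A.VertArr} (β : f ⟶ g), codClass A M β →
      codClass A M (P.lift.functor.map β) := fun β hβ => by
    refine ⟨?_, ?_⟩
    · have := hβ.1
      exact (P.lift.dmap_map β).symm ▸ this
    · exact (P.lift.cmap_map β).symm ▸ hT.map_mem _ hβ.2
  refine ⟨⟨codClass_isMultiplicative, hU.hasIndexedColimitsIn, hU.closedUnderCobaseChange⟩,
    unit_mem, ?_, ?_⟩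
  · intro f g p β inl inr sq hβ
    have sq' : IsPushout (A.cmap β) (T.unit.app f.tgt) (A.cmap inl) (A.cmap inr) := by
      have := hU.preservesCells.isPushout sq hβ
      rw [← P.cmap_unit f]
      exact this
    have hinl : codClass A M inl := hU.closedUnderCobaseChange.of_isPushout sq.flip (unit_mem f)
    have h₁ := sq.inl_desc (P.unit.app g) (P.lift.functor.map β) (P.unit.naturality β)
    have h₂ := sq.inr_desc (P.unit.app g) (P.lift.functor.map β) (P.unit.naturality β)
    change codClass A M (sq.desc (P.unit.app g) (P.lift.functor.map β) (P.unit.naturality β))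
    generalize sq.desc (P.unit.app g) (P.lift.functor.map β) (P.unit.naturality β) = δ at h₁ h₂
    have d₁ := congrArg A.dmap h₁
    rw [A.dmap_comp, P.dmap_unit] at d₁
    have c₁ := congrArg A.cmap h₁
    rw [A.cmap_comp, P.cmap_unit] at c₁
    have c₂ := congrArg A.cmap h₂
    rw [A.cmap_comp] at c₂
    replace c₂ := c₂.trans (P.lift.cmap_map β)
    constructor
    · have := hinl.1
      have : IsIso (A.dmap inl ≫ A.dmap δ) := d₁ ▸ inferInstanceAs (IsIso (𝟙 g.src))
      exact IsIso.of_isIso_comp_left (A.dmap inl) _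
    · rw [sq'.hom_ext (c₁.trans (sq'.inl_desc _ _ (T.unit.naturality (A.cmap β))).symm)
        (c₂.trans (sq'.inr_desc _ _ (T.unit.naturality (A.cmap β))).symm)]
      exact hT.leibniz_mem _ _ _ sq' hβ.2
  · intro F hF
    have hF' : ∀ ⦃i j : Set.Iio κ⦄ (f : i ⟶ j), codClass A M ((F ⋙ P.lift.functor).map f) :=
      fun i j f => map_mem _ (hF f)
    have hcol := hU.hasIndexedColimitsIn κ pos le_rfl
    have := hcol.hasColimit _ hF'
    have := hU.preservesCells.preservesColimit κ pos le_rfl F hF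
    have := hU.preservesCells.preservesColimit κ pos le_rfl _ hF'
    have := hT.convergence (F ⋙ codFunctor A) fun i j f => (hF f).2
    let d := colimit.cocone (F ⋙ P.lift.functor)
    have hd : IsColimit d := colimit.isColimit _
    have hd' := isColimitOfPreserves (codFunctor A) hd
    refine ⟨fun {c} hc => ⟨?_⟩⟩
    have hc' := isColimitOfPreserves T.functor (isColimitOfPreserves (codFunctor A) hc)
    let k : d.pt ⟶ P.lift.functor.obj c.pt := hd.desc (P.lift.functor.mapCocone c)
    have hk : ∀ i, d.ι.app i ≫ k = P.lift.functor.map (c.ι.app i) :=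
      fun i => hd.fac (P.lift.functor.mapCocone c) i
    let δ : ∀ i, T.functor.obj (F.obj i).tgt ⟶ d.pt.tgt := fun i => A.cmap (d.ι.app i)
    let k' : d.pt.tgt ⟶ T.functor.obj c.pt.tgt := A.cmap k
    have hcmap : ∀ i, δ i ≫ k' = T.functor.map (A.cmap (c.ι.app i)) := fun i =>
      (A.cmap_comp _ _).symm.trans ((congrArg A.cmap (hk i)).trans (P.lift.cmap_map _))
    -- The domain of `k` is invertible as the coprojections are invertible on domains, and the
    -- codomain is the comparison map for `T`, which preserves the colimit of the codomains.
    have : IsIso k := by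
      refine U.isIso_of_isIso k ?_ ?_
      · have i₀ : Set.Iio κ := ⟨0, pos⟩
        have h₁ : A.dmap (d.ι.app i₀) ≫ A.dmap k = A.dmap (c.ι.app i₀) := by
          rw [← A.dmap_comp]
          exact (congrArg A.dmap (hk i₀)).trans (P.lift.dmap_map _)
        have := (hcol.ι_mem _ hF' d hd i₀).1
        have := (hcol.ι_mem _ hF c hc i₀).1
        have : IsIso (A.dmap (d.ι.app i₀) ≫ A.dmap k) := by rw [h₁]; assumption
        exact IsIso.of_isIso_comp_left (A.dmap (d.ι.app i₀)) _
      · let l : T.functor.obj c.pt.tgt ⟶ d.pt.tgt := hc'.desc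
          { pt := d.pt.tgt
            ι :=
              { app := fun i => A.cmap (d.ι.app i)
                naturality := fun i j f => by
                  have := congrArg A.cmap (d.w f)
                  rw [A.cmap_comp] at this
                  refine Eq.trans ?_ (this.trans (Category.comp_id _).symm)
                  exact congrArg (· ≫ A.cmap (d.ι.app j)) (P.lift.cmap_map (F.map f)).symm } }
        have hl : ∀ i, T.functor.map (A.cmap (c.ι.app i)) ≫ l = δ i :=
          fun i => hc'.fac _ i
        refine ⟨l, hd'.hom_ext fun i => ?_, hc'.hom_ext fun i => ?_⟩
        · change δ i ≫ k' ≫ l = δ i ≫ 𝟙 _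
          rw [reassoc_of% hcmap, hl]
          exact (Category.comp_id _).symm
        · change T.functor.map (A.cmap (c.ι.app i)) ≫ l ≫ k' =
            T.functor.map (A.cmap (c.ι.app i)) ≫ 𝟙 _
          rw [reassoc_of% hl, hcmap]
          exact (Category.comp_id _).symm
    exact hd.ofIsoColimit (Cocone.ext (@asIso _ _ d.pt (P.lift.functor.obj c.pt) k this) hk)

end VerticalConfiguration

/-! ### Free algebras of vertical morphisms -/

section VerticalFreeAlgebras

/-- A map of algebras between free algebras on `X` that respects the generators is invertible. -/
theorem IsFreeAlgebra.isIso {C : Type u} [Category.{v} C] {T : PointedEndofunctor C}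
    {X F F' : C} {η : X ⟶ F} {a : T.functor.obj F ⟶ F} {η' : X ⟶ F'} {a' : T.functor.obj F' ⟶ F'}
    (h : IsFreeAlgebra T η a) (h' : IsFreeAlgebra T η' a') (t : F ⟶ F') (ht : η ≫ t = η')
    (ht' : a ≫ t = T.functor.map t ≫ a') : IsIso t := by
  obtain ⟨r, ⟨hr, hr'⟩, -⟩ := h'.existsUnique a h.unit_act η
  refine ⟨r, h.hom_ext a h.unit_act ?_ ?_ ?_, h'.hom_ext a' h'.unit_act ?_ ?_ ?_⟩
  · rw [reassoc_of% ht, hr, Category.comp_id]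
  · rw [reassoc_of% ht', hr', T.functor.map_comp_assoc]
  · simp
  · rw [reassoc_of% hr, ht, Category.comp_id]
  · rw [reassoc_of% hr', ht', T.functor.map_comp_assoc]
  · simp

theorem IsFreeAlgebra.exists_iso {C : Type u} [Category.{v} C] {T : PointedEndofunctor C}
    {X F F' : C} {η : X ⟶ F} {a : T.functor.obj F ⟶ F} {η' : X ⟶ F'} {a' : T.functor.obj F' ⟶ F'}
    (h : IsFreeAlgebra T η a) (h' : IsFreeAlgebra T η' a') :
    ∃ e : F ≅ F', η ≫ e.hom = η' ∧ a ≫ e.hom = T.functor.map e.hom ≫ a' := by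
  obtain ⟨t, ⟨ht, ht'⟩, -⟩ := h.existsUnique a' h'.unit_act η'
  have := h.isIso h' t ht ht'
  exact ⟨asIso t, ht, ht'⟩

variable {E : Type u} [Category.{v} E] {A : PseudoDoubleCategory.{v, u, v', u'} E}
  {κ : Ordinal.{w}} {M : MorphismProperty E} {T : PointedEndofunctor E}

/-- Vertical morphisms can be transported along isomorphisms of their source and target. -/
theorem NotionOfComposableStructure.exists_transport (U : NotionOfComposableStructure A)
    (G : A.VertArr) {Y Z : E} (d : G.src ≅ Y) (e : G.tgt ≅ Z) :
    ∃ (g : A.Vert Y Z) (i : G ≅ VerticalArrow.of g),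
      A.dmap i.hom = d.hom ∧ A.cmap i.hom = e.hom := by
  let f : Y ⟶ Z := d.inv ≫ U.und G.arr ≫ e.hom
  obtain ⟨G', i, h, hi⟩ := U.isofibration G (Arrow.mk f)
    (Arrow.isoMk (f := U.vert.obj G) (g := Arrow.mk f) d e (by
      change d.hom ≫ d.inv ≫ U.und G.arr ≫ e.hom = U.und G.arr ≫ e.hom
      rw [Iso.hom_inv_id_assoc]))
  rcases G' with @⟨s, t, g⟩
  obtain rfl : s = Y := congrArg (fun a : Arrow E => a.left) h
  obtain rfl : t = Z := congrArg (fun a : Arrow E => a.right) h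
  have key : ∀ (x y : Arrow E) (h : x = y) (hl : x.left = y.left) (hr : x.right = y.right),
      (eqToHom h).left = eqToHom hl ∧ (eqToHom h).right = eqToHom hr := by
    rintro x y rfl _ _
    exact ⟨rfl, rfl⟩
  obtain ⟨hl, hr⟩ := key _ _ h rfl rfl
  refine ⟨g, i, ?_, ?_⟩
  · have h₁ := congrArg CommaMorphism.left hi
    exact (Category.comp_id _).symm.trans ((congrArg (A.dmap i.hom ≫ ·) hl).symm.trans h₁)
  · have h₁ := congrArg CommaMorphism.right hi
    exact (Category.comp_id _).symm.trans ((congrArg (A.cmap i.hom ≫ ·) hr).symm.trans h₁)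

theorem dmap_whisker {X Y Z Z' : E} {g : A.Vert Y Z} {g' : A.Vert Y Z'}
    (σ : VerticalArrow.of g ⟶ VerticalArrow.of g') (hσ : A.dmap σ = 𝟙 Y) (f : A.Vert X Y) :
    A.dmap (whisker A σ hσ f) = 𝟙 X :=
  (A.dmap_vcompMap _ _ _).trans (A.dmap_id (VerticalArrow.of f))

theorem cmap_whisker {X Y Z Z' : E} {g : A.Vert Y Z} {g' : A.Vert Y Z'}
    (σ : VerticalArrow.of g ⟶ VerticalArrow.of g') (hσ : A.dmap σ = 𝟙 Y) (f : A.Vert X Y) :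
    A.cmap (whisker A σ hσ f) = A.cmap σ :=
  A.cmap_vcompMap _ _ _

namespace Point

variable (P : Point A T)

/-- The endomorphism of `T Z` underlying `θ_{g,f}`. The axioms of an `A`-point do not force it to be
the identity. -/
def twist {X Y Z : E} (g : A.Vert Y Z) (f : A.Vert X Y) : T.functor.obj Z ⟶ T.functor.obj Z :=
  A.cmap (P.θ g f).hom

/-- The inverse of `Point.twist`. -/
def twistInv {X Y Z : E} (g : A.Vert Y Z) (f : A.Vert X Y) : T.functor.obj Z ⟶ T.functor.obj Z :=
  A.cmap (P.θ g f).inv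

section

variable {X Y Z Z' : E} (g : A.Vert Y Z) (f : A.Vert X Y) {g' : A.Vert Y Z'}

theorem twist_twistInv : P.twist g f ≫ P.twistInv g f = 𝟙 _ := by
  rw [twist, twistInv, ← A.cmap_comp, Iso.hom_inv_id, A.cmap_id]

theorem twistInv_twist : P.twistInv g f ≫ P.twist g f = 𝟙 _ := by
  rw [twist, twistInv, ← A.cmap_comp, Iso.inv_hom_id, A.cmap_id]

theorem unit_twist : T.unit.app Z ≫ P.twist g f = T.unit.app Z := by
  have h₁ := (A.cmap_comp _ _).symm.trans ((congrArg A.cmap (P.unit_θ g f)).trans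
    (P.cmap_unit (VerticalArrow.of (A.vcomp g f))))
  have h₂ := (cmap_whisker _ (P.dmap_unit (VerticalArrow.of g)) f).trans
    (P.cmap_unit (VerticalArrow.of g))
  exact (congrArg (· ≫ P.twist g f) h₂.symm).trans h₁

theorem unit_twistInv : T.unit.app Z ≫ P.twistInv g f = T.unit.app Z := by
  have := congrArg (· ≫ P.twistInv g f) (P.unit_twist g f)
  dsimp at this
  rw [Category.assoc, twist_twistInv] at this
  exact this.symm.trans (Category.comp_id _)

theorem map_twist (σ : VerticalArrow.of g ⟶ VerticalArrow.of g') (hσ : A.dmap σ = 𝟙 Y) :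
    T.functor.map (A.cmap σ) ≫ P.twist g' f = P.twist g f ≫ T.functor.map (A.cmap σ) := by
  have := congrArg A.cmap (P.θ_naturality σ (𝟙 (VerticalArrow.of f))
    (hσ.trans (A.cmap_id (VerticalArrow.of f)).symm))
  rw [A.cmap_comp, A.cmap_comp, A.cmap_vcompMap, P.lift.cmap_map, P.lift.cmap_map,
    A.cmap_vcompMap] at this
  exact this

theorem map_twistInv (σ : VerticalArrow.of g ⟶ VerticalArrow.of g') (hσ : A.dmap σ = 𝟙 Y) :
    T.functor.map (A.cmap σ) ≫ P.twistInv g' f = P.twistInv g f ≫ T.functor.map (A.cmap σ) := by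
  have h := P.map_twist g f σ hσ
  have h' := congrArg (fun t => P.twistInv g f ≫ t ≫ P.twistInv g' f) h
  dsimp at h'
  rw [Category.assoc, twist_twistInv, Category.assoc, ← Category.assoc (P.twistInv g f),
    ← Category.assoc (P.twistInv g f) (P.twist g f), twistInv_twist, Category.id_comp] at h'
  rw [← h', Category.comp_id]

end

/-- As the unit is the identity on domains, so is the action of any algebra. -/
theorem dmap_act {g : A.VertArr} (b : VerticalArrow.of (P.lift.obj g.arr) ⟶ g)
    (hb : P.unit.app g ≫ b = 𝟙 g) : A.dmap b = 𝟙 g.src := by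
  have := (A.dmap_comp (P.unit.app g) b).symm.trans ((congrArg A.dmap hb).trans (A.dmap_id g))
  rw [P.dmap_unit] at this
  exact (Category.id_comp _).symm.trans this

theorem unit_cmap_act {g : A.VertArr} (b : VerticalArrow.of (P.lift.obj g.arr) ⟶ g)
    (hb : P.unit.app g ≫ b = 𝟙 g) : T.unit.app g.tgt ≫ A.cmap b = 𝟙 g.tgt := by
  have := (A.cmap_comp (P.unit.app g) b).symm.trans ((congrArg A.cmap hb).trans (A.cmap_id g))
  rwa [P.cmap_unit] at this

end Point

/-- A choice, for all vertical morphisms `g`, of free algebras strictly over those given by a monad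
`F`, with respect to a morphism `γ : T ⟶ F`. The codomains are required to be free also when their
action is twisted by the isomorphisms `θ` of the `A`-point `P`. -/
structure FreePoints (P : Point A T) {F : Monad E} (γ : T ⟶ underPtd F) where
  obj : ∀ {X Y : E}, A.Vert X Y → A.Vert X (F.obj Y)
  η : ∀ {X Y : E} (g : A.Vert X Y), VerticalArrow.of g ⟶ VerticalArrow.of (obj g)
  act : ∀ {X Y : E} (g : A.Vert X Y),
    VerticalArrow.of (P.lift.obj (obj g)) ⟶ VerticalArrow.of (obj g)
  dmap_η : ∀ {X Y : E} (g : A.Vert X Y), A.dmap (η g) = 𝟙 X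
  cmap_η : ∀ {X Y : E} (g : A.Vert X Y), A.cmap (η g) = F.η.app Y
  cmap_act : ∀ {X Y : E} (g : A.Vert X Y), A.cmap (act g) = freeAct γ Y
  isFree : ∀ {X Y : E} (g : A.Vert X Y), IsFreeAlgebra P.pointed (η g) (act g)
  isFree_twist : ∀ {X Y Z : E} (g : A.Vert Y Z) (f : A.Vert X Y),
    IsFreeAlgebra T (F.η.app Z) (P.twistInv (obj g) f ≫ freeAct γ Z)

/-- Free algebras on a vertical morphism `g` can be chosen strictly over given free algebras. The
universal property is tested along the vertical codomain functor, both in its plain form and in the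
form twisted by `θ`. -/
theorem exists_strict_freeAlgebra (hT : IsConfiguration κ M T) (hκ : Order.IsSuccLimit κ)
    (U : NotionOfComposableStructure A) (hU : U.IsCellular κ M) (P : Point A T) {Y Z F : E}
    {ε : Z ⟶ F} {α : T.functor.obj F ⟶ F} (hF : IsFreeAlgebra T ε α) (g : A.Vert Y Z) :
    ∃ (g' : A.Vert Y F) (η : VerticalArrow.of g ⟶ VerticalArrow.of g')
      (a : VerticalArrow.of (P.lift.obj g') ⟶ VerticalArrow.of g'),
      A.dmap η = 𝟙 Y ∧ A.cmap η = ε ∧ A.cmap a = α ∧ IsFreeAlgebra P.pointed η a ∧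
      ∀ {X : E} (f : A.Vert X Y), IsFreeAlgebra T ε (P.twistInv g' f ≫ α) := by
  obtain ⟨G, η, a, hη, ha, h₁, h₂⟩ := (hT.vertical hκ hU P).exists_isFreeAlong hκ
    (PreservesCells.id κ (codClass A M)) hU.preservesCells (VerticalArrow.of g)
  have hfree := h₁.isFreeAlgebra hη ha
  let cη : Z ⟶ G.tgt := A.cmap η
  let ca : T.functor.obj G.tgt ⟶ G.tgt := A.cmap a
  have hca : T.unit.app G.tgt ≫ ca = 𝟙 G.tgt := P.unit_cmap_act a ha
  -- The vertical codomain functor intertwines the two pointed endofunctors strictly.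
  have hcod : IsFreeAlgebra T cη ca := by
    refine ⟨hca, fun B b hb k => ?_⟩
    have : ∃! h : G.tgt ⟶ B, cη ≫ h = k ∧
        ca ≫ h = 𝟙 (T.functor.obj G.tgt) ≫ T.functor.map h ≫ b :=
      h₂ T
        { app := fun {G} _ _ => 𝟙 (T.functor.obj G.tgt)
          naturality := fun _ _ m _ => (Category.comp_id _).trans
            ((P.lift.cmap_map m).trans (Category.id_comp _).symm)
          unit_app := fun {G} {_} _ => (Category.comp_id _).trans (P.cmap_unit G) } hη B b hb k
    simpa only [Category.id_comp] using this
  obtain ⟨e, he, he'⟩ := hcod.exists_iso hF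
  have := hη.1
  have hd : A.dmap η ≫ inv (A.dmap η) = 𝟙 Y := IsIso.hom_inv_id _
  obtain ⟨g', i, hi, hi'⟩ := U.exists_transport G (asIso (A.dmap η)).symm e
  refine ⟨g', η ≫ i.hom, P.lift.functor.map i.inv ≫ a ≫ i.hom, ?_, ?_, ?_, ?_, fun {X} f => ?_⟩
  · rw [A.dmap_comp, hi]
    exact hd
  · rw [A.cmap_comp, hi']
    exact he
  · have h : A.cmap i.inv ≫ A.cmap i.hom = 𝟙 F :=
      (A.cmap_comp _ _).symm.trans ((congrArg A.cmap i.inv_hom_id).trans (A.cmap_id _))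
    rw [hi'] at h
    have h' : A.cmap (a ≫ i.hom) = T.functor.map e.hom ≫ α :=
      (A.cmap_comp _ _).trans ((congrArg (ca ≫ ·) hi').trans he')
    refine (A.cmap_comp _ _).trans ?_
    refine (congrArg₂ (· ≫ ·) (P.lift.cmap_map i.inv) h').trans ?_
    refine (Category.assoc _ _ _).symm.trans ?_
    have h₃ := congrArg T.functor.map h
    rw [T.functor.map_comp, T.functor.map_id] at h₃
    exact (congrArg (· ≫ α) h₃).trans (Category.id_comp _)
  · refine hfree.of_iso i rfl ?_
    have : P.lift.functor.map i.hom ≫ P.lift.functor.map i.inv = 𝟙 _ := by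
      rw [← P.lift.functor.map_comp, i.hom_inv_id, P.lift.functor.map_id]
    exact (Category.id_comp _).symm.trans ((congrArg (· ≫ a ≫ i.hom) this.symm).trans
      (Category.assoc _ _ _))
  · -- Objects under `g` are transported to vertical morphisms with source `Y`, so that they become
    -- composable with `f` and have a twist.
    have hex : ∀ (H : A.VertArr) (x : VerticalArrow.of g ⟶ H), codClass A M x →
        ∃ (h : A.Vert Y H.tgt) (j : H ≅ VerticalArrow.of h),
          A.dmap x ≫ A.dmap j.hom = 𝟙 Y ∧ A.cmap j.hom = 𝟙 H.tgt := fun H x hx => by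
      have := hx.1
      obtain ⟨h, j, hj, hj'⟩ := U.exists_transport H (asIso (A.dmap x)).symm (Iso.refl _)
      exact ⟨h, j, hj ▸ (IsIso.hom_inv_id (A.dmap x)), hj'⟩
    choose tr j hj hj' using hex
    have hjinv : ∀ (H : A.VertArr) (x : VerticalArrow.of g ⟶ H) (hx : codClass A M x),
        A.dmap (j H x hx).inv = A.dmap x ∧ A.cmap (j H x hx).inv = 𝟙 H.tgt := fun H x hx => by
      have h₁ := congrArg A.dmap (j H x hx).hom_inv_id
      have h₂ := congrArg A.cmap (j H x hx).hom_inv_id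
      rw [A.dmap_comp, A.dmap_id] at h₁
      rw [A.cmap_comp, A.cmap_id, hj'] at h₂
      refine ⟨?_, (Category.id_comp _).symm.trans h₂⟩
      have h₃ := congrArg (A.dmap x ≫ ·) h₁
      dsimp at h₃
      rw [reassoc_of% (hj H x hx)] at h₃
      exact h₃.trans (Category.comp_id _)
    have hσ : ∀ {H H' : A.VertArr} (x : VerticalArrow.of g ⟶ H) (x' : VerticalArrow.of g ⟶ H')
        (hx : codClass A M x) (hx' : codClass A M x') (m : H ⟶ H'), x ≫ m = x' →
        A.dmap ((j H x hx).inv ≫ m ≫ (j H' x' hx').hom) = 𝟙 Y ∧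
        A.cmap ((j H x hx).inv ≫ m ≫ (j H' x' hx').hom) = A.cmap m := by
      rintro H H' x x' hx hx' m rfl
      have h := hj _ _ hx'
      rw [A.dmap_comp] at h
      rw [A.dmap_comp, A.dmap_comp, A.cmap_comp, A.cmap_comp, hj', (hjinv H x hx).1,
        (hjinv H x hx).2]
      exact ⟨(Category.assoc _ _ _).symm.trans h,
        (Category.id_comp _).trans (Category.comp_id _)⟩
    let ψ : PartialTransformation (codClass A M) P.pointed (VerticalArrow.of g)
        (codFunctor A) T :=
      { app := fun {H} x hx => P.twist (tr H x hx) f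
        naturality := fun {H H'} {x x'} hx hx' m hm => by
          obtain ⟨h₁, h₂⟩ := hσ x x' hx hx' m hm
          have := P.map_twist _ f _ h₁
          rw [h₂] at this
          exact (congrArg (· ≫ P.twist (tr H' x' hx') f) (P.lift.cmap_map m)).trans this
        unit_app := fun {H} {x} hx =>
          (congrArg (· ≫ P.twist (tr H x hx) f) (P.cmap_unit H)).trans (P.unit_twist _ f) }
    have hfree' : IsFreeAlgebra T cη (P.twistInv (tr G η hη) f ≫ ca) := by
      refine ⟨?_, fun B b hb k => ?_⟩
      · rw [reassoc_of% (P.unit_twistInv (tr G η hη) f)]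
        exact hca
      · have : ∃! h : G.tgt ⟶ B, cη ≫ h = k ∧
          ca ≫ h = P.twist (tr G η hη) f ≫ T.functor.map h ≫ b := h₂ T ψ hη B b hb k
        have key : ∀ h : G.tgt ⟶ B,
            (ca ≫ h = P.twist (tr G η hη) f ≫ T.functor.map h ≫ b) ↔
            ((P.twistInv (tr G η hη) f ≫ ca) ≫ h = T.functor.map h ≫ b) := fun h => by
          constructor
          · intro w
            rw [Category.assoc]
            refine (congrArg (P.twistInv (tr G η hη) f ≫ ·) w).trans ?_
            rw [reassoc_of% (P.twistInv_twist (tr G η hη) f)]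
          · intro w
            rw [← w, Category.assoc, reassoc_of% (P.twist_twistInv (tr G η hη) f)]
        simpa only [key] using this
    refine hfree'.of_iso e he ?_
    have hσ₁ : A.dmap ((j G η hη).inv ≫ i.hom) = 𝟙 Y := by
      rw [A.dmap_comp, (hjinv _ _ _).1, hi]
      exact hd
    have hσ₂ : A.cmap ((j G η hη).inv ≫ i.hom) = e.hom := by
      rw [A.cmap_comp, (hjinv _ _ _).2, hi']
      exact Category.id_comp _
    have := P.map_twistInv (tr G η hη) f _ hσ₁
    rw [hσ₂] at this
    rw [reassoc_of% this, Category.assoc, he']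

theorem exists_freePoints (hT : IsConfiguration κ M T) (hκ : Order.IsSuccLimit κ)
    (U : NotionOfComposableStructure A) (hU : U.IsCellular κ M) (P : Point A T) {F : Monad E}
    (γ : T ⟶ underPtd F) (hγ : ∀ X, IsFreeAlgebra T (F.η.app X) (freeAct γ X)) :
    Nonempty (FreePoints P γ) := by
  choose obj η act h₁ h₂ h₃ h₄ h₅ using
    fun (X Y : E) (g : A.Vert X Y) => exists_strict_freeAlgebra hT hκ U hU P (hγ Y) g
  exact ⟨⟨fun g => obj _ _ g, fun g => η _ _ g, fun g => act _ _ g, fun g => h₁ _ _ g,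
    fun g => h₂ _ _ g, fun g => h₃ _ _ g, fun g => h₄ _ _ g, fun g f => h₅ _ _ g f⟩⟩

end VerticalFreeAlgebras

/-! ### Algebras and vertical composition -/

section VerticalAlgebras

variable {E : Type u} [Category.{v} E] {A : PseudoDoubleCategory.{v, u, v', u'} E}
  {T : PointedEndofunctor E}

theorem vcompMap_congr {X Y Z X' Y' Z' : E} {g : A.Vert Y Z} {f : A.Vert X Y} {g' : A.Vert Y' Z'}
    {f' : A.Vert X' Y'} {σ σ' : VerticalArrow.of g ⟶ VerticalArrow.of g'}
    {β β' : VerticalArrow.of f ⟶ VerticalArrow.of f'} (hσ : σ = σ') (hβ : β = β')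
    (h : A.dmap σ = A.cmap β) (h' : A.dmap σ' = A.cmap β') :
    A.vcompMap σ β h = A.vcompMap σ' β' h' := by
  subst hσ hβ
  rfl

section

variable {X Y Z Z' Z'' : E} {g : A.Vert Y Z} {g' : A.Vert Y Z'} {g'' : A.Vert Y Z''}

theorem whisker_id (f : A.Vert X Y) (σ : VerticalArrow.of g ⟶ VerticalArrow.of g)
    (hσ : A.dmap σ = 𝟙 Y) (h : σ = 𝟙 _) : whisker A σ hσ f = 𝟙 _ :=
  (vcompMap_congr h rfl _ _).trans (A.vcompMap_id g f)

theorem whisker_comp (f : A.Vert X Y) (σ : VerticalArrow.of g ⟶ VerticalArrow.of g')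
    (σ' : VerticalArrow.of g' ⟶ VerticalArrow.of g'') (σ'' : VerticalArrow.of g ⟶ VerticalArrow.of g'')
    (hσ : A.dmap σ = 𝟙 Y) (hσ' : A.dmap σ' = 𝟙 Y) (hσ'' : A.dmap σ'' = 𝟙 Y) (h : σ ≫ σ' = σ'') :
    whisker A σ hσ f ≫ whisker A σ' hσ' f = whisker A σ'' hσ'' f :=
  (A.vcompMap_comp _ _ _ _ _ _).symm.trans (vcompMap_congr h (Category.id_comp _) _ _)

variable {X' Y' W : E} {k : A.Vert Y' W} {f : A.Vert X Y} {f' : A.Vert X' Y'}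
  (β : VerticalArrow.of f ⟶ VerticalArrow.of f')

theorem whisker_vcompMap (σ : VerticalArrow.of g ⟶ VerticalArrow.of g') (hσ : A.dmap σ = 𝟙 Y)
    (σ' : VerticalArrow.of g' ⟶ VerticalArrow.of k) (h : A.dmap σ' = A.cmap β)
    (ρ : VerticalArrow.of g ⟶ VerticalArrow.of k) (h' : A.dmap ρ = A.cmap β) (e : σ ≫ σ' = ρ) :
    whisker A σ hσ f ≫ A.vcompMap σ' β h = A.vcompMap ρ β h' :=
  (A.vcompMap_comp _ _ _ _ _ _).symm.trans (vcompMap_congr e (Category.id_comp _) _ _)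

theorem vcompMap_whisker {W' : E} {k' : A.Vert Y' W'}
    (σ : VerticalArrow.of g ⟶ VerticalArrow.of k) (h : A.dmap σ = A.cmap β)
    (σ' : VerticalArrow.of k ⟶ VerticalArrow.of k') (hσ' : A.dmap σ' = 𝟙 Y')
    (ρ : VerticalArrow.of g ⟶ VerticalArrow.of k') (h' : A.dmap ρ = A.cmap β) (e : σ ≫ σ' = ρ) :
    A.vcompMap σ β h ≫ whisker A σ' hσ' f' = A.vcompMap ρ β h' :=
  (A.vcompMap_comp _ _ _ _ _ _).symm.trans (vcompMap_congr e (Category.comp_id _) _ _)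

end

namespace Point

variable (P : Point A T)

theorem θ_inv_naturality {X Y Z X' Y' Z' : E} {g : A.Vert Y Z} {f : A.Vert X Y} {g' : A.Vert Y' Z'}
    {f' : A.Vert X' Y'} (σ : VerticalArrow.of g ⟶ VerticalArrow.of g')
    (β : VerticalArrow.of f ⟶ VerticalArrow.of f') (h : A.dmap σ = A.cmap β) :
    (P.θ g f).inv ≫ A.vcompMap (P.lift.map σ) β ((P.lift.dmap_map σ).trans h) =
      P.lift.map (A.vcompMap σ β h) ≫ (P.θ g' f').inv := by
  rw [Iso.inv_comp_eq, ← Category.assoc, Iso.eq_comp_inv]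
  exact P.θ_naturality σ β h

/-- An algebra structure on `g` for the pointed endofunctor of an `A`-point induces one on the
vertical composite `g ⋆ f`. -/
def compAct {X Y Z : E} {g : A.Vert Y Z}
    (b : VerticalArrow.of (P.lift.obj g) ⟶ VerticalArrow.of g) (hb : A.dmap b = 𝟙 Y)
    (f : A.Vert X Y) : VerticalArrow.of (P.lift.obj (A.vcomp g f)) ⟶ VerticalArrow.of (A.vcomp g f) :=
  (P.θ g f).inv ≫ whisker A b hb f

section

variable {X Y Z X' Y' Z' : E} {g : A.Vert Y Z}
  (b : VerticalArrow.of (P.lift.obj g) ⟶ VerticalArrow.of g) (hb : A.dmap b = 𝟙 Y)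
  (f : A.Vert X Y)

theorem cmap_compAct : A.cmap (P.compAct b hb f) = P.twistInv g f ≫ A.cmap b :=
  (A.cmap_comp _ _).trans (congrArg (P.twistInv g f ≫ ·) (cmap_whisker b hb f))

theorem unit_compAct (h : P.unit.app (VerticalArrow.of g) ≫ b = 𝟙 _) :
    P.unit.app (VerticalArrow.of (A.vcomp g f)) ≫ P.compAct b hb f = 𝟙 _ := by
  have h₁ := P.unit_θ g f
  have h₂ := whisker_comp f _ b _ (P.dmap_unit (VerticalArrow.of g)) hb (A.dmap_id _) h
  have h₃ := h₂.trans (whisker_id f _ _ rfl)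
  have h₄ := congrArg (· ≫ P.compAct b hb f) h₁.symm
  refine h₄.trans (Eq.trans ?_ h₃)
  refine (Category.assoc _ _ _).trans ?_
  exact congrArg (whisker A (P.unit.app (VerticalArrow.of g)) _ f ≫ ·) (Iso.hom_inv_id_assoc _ _)

/-- Vertical composition preserves maps of algebras. -/
theorem compAct_vcompMap {g' : A.Vert Y' Z'} {f' : A.Vert X' Y'}
    (b' : VerticalArrow.of (P.lift.obj g') ⟶ VerticalArrow.of g') (hb' : A.dmap b' = 𝟙 Y')
    (σ : VerticalArrow.of g ⟶ VerticalArrow.of g') (β : VerticalArrow.of f ⟶ VerticalArrow.of f')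
    (h : A.dmap σ = A.cmap β) (hσ : b ≫ σ = P.lift.map σ ≫ b') :
    P.compAct b hb f ≫ A.vcompMap σ β h =
      P.lift.map (A.vcompMap σ β h) ≫ P.compAct b' hb' f' := by
  have hρ : A.dmap (b ≫ σ) = A.cmap β := by
    rw [A.dmap_comp, hb, h]
    exact Category.id_comp _
  have h₁ := whisker_vcompMap β b hb σ h _ hρ rfl
  have h₂ := vcompMap_whisker β (P.lift.map σ) ((P.lift.dmap_map σ).trans h) b' hb' _ hρ hσ.symm
  rw [compAct, compAct, Category.assoc, h₁, ← reassoc_of% (P.θ_inv_naturality σ β h), h₂]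

theorem compAct_whisker {g' : A.Vert Y Z'}
    (b' : VerticalArrow.of (P.lift.obj g') ⟶ VerticalArrow.of g') (hb' : A.dmap b' = 𝟙 Y)
    (σ : VerticalArrow.of g ⟶ VerticalArrow.of g') (hσ' : A.dmap σ = 𝟙 Y)
    (hσ : b ≫ σ = P.lift.map σ ≫ b') :
    P.compAct b hb f ≫ whisker A σ hσ' f = P.lift.map (whisker A σ hσ' f) ≫ P.compAct b' hb' f :=
  P.compAct_vcompMap b hb f b' hb' σ (𝟙 _) _ hσ

end

end Point

end VerticalAlgebras

/-! ### The free monad on vertical morphisms -/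

section VerticalFreeMonad

variable {E : Type u} [Category.{v} E] {A : PseudoDoubleCategory.{v, u, v', u'} E}
  {T : PointedEndofunctor E} {P : Point A T} {F : Monad E} {γ : T ⟶ underPtd F}

namespace FreePoints

variable (D : FreePoints P γ)

/-- The free algebras on vertical morphisms, without their strictness. -/
@[reducible]
def algebras : FreeAlgebras P.pointed where
  obj g := VerticalArrow.of (D.obj g.arr)
  η g := D.η g.arr
  act g := D.act g.arr
  isFree g := D.isFree g.arr

theorem dmap_η_comp {g h : A.VertArr} (k : D.algebras.obj g ⟶ h) :
    A.dmap (D.algebras.η g ≫ k) = A.dmap k := by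
  rw [A.dmap_comp]
  exact (congrArg (· ≫ A.dmap k) (D.dmap_η g.arr)).trans (Category.id_comp _)

theorem cmap_η_comp {g h : A.VertArr} (k : D.algebras.obj g ⟶ h) :
    A.cmap (D.algebras.η g ≫ k) = F.η.app g.tgt ≫ A.cmap k := by
  rw [A.cmap_comp]
  exact (congrArg (· ≫ A.cmap k) (D.cmap_η g.arr))

theorem dmap_act (g : A.VertArr) : A.dmap (D.algebras.act g) = 𝟙 g.src :=
  P.dmap_act (g := VerticalArrow.of (D.obj g.arr)) (D.act g.arr) (D.isFree g.arr).unit_act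

/-- The vertical codomain of a map out of a free algebra is a map of algebras. -/
theorem freeAct_cmap {g h : A.VertArr} (k : D.algebras.obj g ⟶ h)
    (b : VerticalArrow.of (P.lift.obj h.arr) ⟶ h)
    (hk : D.algebras.act g ≫ k = P.lift.functor.map k ≫ b) :
    freeAct γ g.tgt ≫ A.cmap k = T.functor.map (A.cmap k) ≫ A.cmap b := by
  have := (A.cmap_comp _ _).symm.trans ((congrArg A.cmap hk).trans (A.cmap_comp _ _))
  refine (congrArg (· ≫ A.cmap k) (D.cmap_act g.arr)).symm.trans (this.trans ?_)
  exact congrArg (· ≫ A.cmap b) (P.lift.cmap_map k)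

theorem cmap_eq (hγ : ∀ X, IsFreeAlgebra T (F.η.app X) (freeAct γ X)) {g h : A.VertArr}
    (k : D.algebras.obj g ⟶ h) (b : VerticalArrow.of (P.lift.obj h.arr) ⟶ h)
    (hb : P.unit.app h ≫ b = 𝟙 h)
    (hk : D.algebras.act g ≫ k = P.lift.functor.map k ≫ b) (l : F.obj g.tgt ⟶ h.tgt)
    (hl : F.η.app g.tgt ≫ l = A.cmap (D.algebras.η g ≫ k))
    (hl' : freeAct γ g.tgt ≫ l = T.functor.map l ≫ A.cmap b) : A.cmap k = l :=
  (hγ g.tgt).hom_ext (A.cmap b) (P.unit_cmap_act b hb) ((D.cmap_η_comp k).symm.trans hl.symm)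
    (D.freeAct_cmap k b hk) hl'

theorem dmap_map {g h : A.VertArr} (β : g ⟶ h) : A.dmap (D.algebras.map β) = A.dmap β := by
  have := D.dmap_η_comp (D.algebras.map β)
  rw [FreeAlgebras.η_map] at this
  refine this.symm.trans ((A.dmap_comp _ _).trans ?_)
  exact (congrArg (A.dmap β ≫ ·) (D.dmap_η h.arr)).trans (Category.comp_id _)

theorem cmap_map (hγ : ∀ X, IsFreeAlgebra T (F.η.app X) (freeAct γ X)) {g h : A.VertArr}
    (β : g ⟶ h) : A.cmap (D.algebras.map β) = F.map (A.cmap β) := by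
  refine D.cmap_eq hγ (D.algebras.map β) (D.act h.arr) (D.isFree h.arr).unit_act
    (D.algebras.act_map β) _ ?_ ?_
  · rw [FreeAlgebras.η_map]
    refine (F.η.naturality (A.cmap β)).symm.trans (Eq.trans ?_
      (A.cmap_comp β (D.algebras.η h)).symm)
    exact (congrArg (A.cmap β ≫ ·) (D.cmap_η h.arr)).symm
  · rw [D.cmap_act]
    exact freeAct_map γ _

theorem dmap_μ (g : A.VertArr) : A.dmap (D.algebras.μ g) = 𝟙 g.src := by
  have := D.dmap_η_comp (D.algebras.μ g)
  rw [FreeAlgebras.η_μ] at this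
  exact this.symm.trans (A.dmap_id _)

theorem cmap_μ (hγ : ∀ X, IsFreeAlgebra T (F.η.app X) (freeAct γ X)) (g : A.VertArr) :
    A.cmap (D.algebras.μ g) = F.μ.app g.tgt := by
  refine D.cmap_eq hγ (D.algebras.μ g) (D.act g.arr) (D.isFree g.arr).unit_act
    (D.algebras.act_μ g) _ ?_ ?_
  · rw [FreeAlgebras.η_μ]
    exact (F.left_unit g.tgt).trans (A.cmap_id (D.algebras.obj g)).symm
  · rw [D.cmap_act]
    exact freeAct_μ γ _

/-- The comparison map between the free algebra on `g ⋆ f` and the algebra on the composite of the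
free algebra on `g` with `f`. -/
noncomputable def comparison {X Y Z : E} (g : A.Vert Y Z) (f : A.Vert X Y) :
    VerticalArrow.of (D.obj (A.vcomp g f)) ⟶ VerticalArrow.of (A.vcomp (D.obj g) f) :=
  D.algebras.desc (X := VerticalArrow.of (A.vcomp g f)) (B := VerticalArrow.of (A.vcomp (D.obj g) f))
    (whisker A (D.η g) (D.dmap_η g) f)
    (P.compAct (D.act g) (D.dmap_act (VerticalArrow.of g)) f)
    (P.unit_compAct _ _ _ (D.isFree g).unit_act)

section

variable {X Y Z : E} (g : A.Vert Y Z) (f : A.Vert X Y)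

theorem η_comparison :
    D.η (A.vcomp g f) ≫ D.comparison g f = whisker A (D.η g) (D.dmap_η g) f :=
  D.algebras.η_desc (X := VerticalArrow.of (A.vcomp g f)) _ _ _

theorem act_comparison : D.act (A.vcomp g f) ≫ D.comparison g f =
    P.lift.map (D.comparison g f) ≫ P.compAct (D.act g) (D.dmap_act (VerticalArrow.of g)) f :=
  D.algebras.act_desc (X := VerticalArrow.of (A.vcomp g f)) _ _ _

theorem isIso_comparison (U : NotionOfComposableStructure A)
    (hγ : ∀ X, IsFreeAlgebra T (F.η.app X) (freeAct γ X)) : IsIso (D.comparison g f) := by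
  refine U.isIso_of_isIso _ ?_ ?_
  · have h : A.dmap (D.comparison g f) = 𝟙 X :=
      (D.dmap_η_comp (g := VerticalArrow.of (A.vcomp g f)) (D.comparison g f)).symm.trans
        ((congrArg A.dmap (D.η_comparison g f)).trans (dmap_whisker _ _ _))
    exact h ▸ inferInstanceAs (IsIso (𝟙 X))
  · refine (hγ Z).isIso (D.isFree_twist g f) (A.cmap (D.comparison g f)) ?_ ?_
    · refine (D.cmap_η_comp (g := VerticalArrow.of (A.vcomp g f)) (D.comparison g f)).symm.trans ?_
      exact (congrArg A.cmap (D.η_comparison g f)).trans ((cmap_whisker _ _ _).trans (D.cmap_η g))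
    · have := D.freeAct_cmap (g := VerticalArrow.of (A.vcomp g f)) _ _ (D.act_comparison g f)
      refine this.trans (congrArg (T.functor.map (A.cmap (D.comparison g f)) ≫ ·) ?_)
      refine (P.cmap_compAct _ _ _).trans ?_
      exact congrArg (P.twistInv (D.obj g) f ≫ ·) (D.cmap_act g)

end

end FreePoints

end VerticalFreeMonad

/-! ### The free monad as a point -/

/-- Maps of algebras compose. -/
theorem act_comp {C : Type u} [Category.{v} C] {T : PointedEndofunctor C} {X Y Z : C}
    {a : T.functor.obj X ⟶ X} {b : T.functor.obj Y ⟶ Y} {c : T.functor.obj Z ⟶ Z} {f : X ⟶ Y}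
    {g : Y ⟶ Z} (hf : a ≫ f = T.functor.map f ≫ b) (hg : b ≫ g = T.functor.map g ≫ c) :
    a ≫ f ≫ g = T.functor.map (f ≫ g) ≫ c := by
  rw [reassoc_of% hf, hg, T.functor.map_comp_assoc]

section FreeMonadPoint

variable {E : Type u} [Category.{v} E] {A : PseudoDoubleCategory.{v, u, v', u'} E}
  {T : PointedEndofunctor E} {P : Point A T} {F : Monad E} {γ : T ⟶ underPtd F}

namespace FreePoints

variable (D : FreePoints P γ)

/-- The comparison maps are natural, for squares in both arguments. -/
theorem comparison_naturality {X Y Z X' Y' Z' : E} {g : A.Vert Y Z} {f : A.Vert X Y} {g' : A.Vert Y' Z'}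
    {f' : A.Vert X' Y'} (σ : VerticalArrow.of g ⟶ VerticalArrow.of g')
    (β : VerticalArrow.of f ⟶ VerticalArrow.of f') (h : A.dmap σ = A.cmap β)
    (σ' : VerticalArrow.of (D.obj g) ⟶ VerticalArrow.of (D.obj g')) (hσ' : σ' = D.algebras.map σ)
    (h' : A.dmap σ' = A.cmap β) :
    D.comparison g f ≫ A.vcompMap σ' β h' =
      D.algebras.map (A.vcompMap σ β h) ≫ D.comparison g' f' := by
  have e : D.η g ≫ σ' = σ ≫ D.η g' := hσ' ▸ D.algebras.η_map σ
  have e' : D.act g ≫ σ' = P.lift.map σ' ≫ D.act g' := hσ' ▸ D.algebras.act_map σ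
  have hρ : A.dmap (σ ≫ D.η g') = A.cmap β := by
    rw [A.dmap_comp, D.dmap_η, h]
    exact Category.comp_id _
  refine (D.isFree (A.vcomp g f)).hom_ext
    (P.compAct (D.act g') (D.dmap_act (VerticalArrow.of g')) f')
    (P.unit_compAct _ _ _ (D.isFree g').unit_act) ?_ ?_ ?_
  · have h₁ := whisker_vcompMap β (D.η g) (D.dmap_η g) σ' h' _ hρ e
    have h₂ := vcompMap_whisker β σ h (D.η g') (D.dmap_η g') _ hρ rfl
    rw [reassoc_of% (D.η_comparison g f), h₁, ← h₂, ← η_comparison]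
    exact (D.algebras.η_map_assoc (A.vcompMap σ β h) (D.comparison g' f')).symm
  · exact act_comp (T := P.pointed) (D.act_comparison g f) (P.compAct_vcompMap _ _ f _ _ σ' β h' e')
  · exact act_comp (D.algebras.act_map (A.vcompMap σ β h)) (D.act_comparison g' f')

/-- The comparison maps are compatible with the multiplication. The inverse `i` of the comparison map
and the multiplication `m` are variables so that their sources and targets are literally of the form
required by vertical composition. -/
theorem comparison_μ {X Y Z : E} (g : A.Vert Y Z) (f : A.Vert X Y) (i : VerticalArrow.of (A.vcomp (D.obj g) f) ⟶
      VerticalArrow.of (D.obj (A.vcomp g f))) (hi : i ≫ D.comparison g f = 𝟙 _)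
    (m : VerticalArrow.of (D.obj (D.obj g)) ⟶ VerticalArrow.of (D.obj g))
    (hm : m = D.algebras.μ (VerticalArrow.of g)) (hm' : A.dmap m = 𝟙 Y) :
    D.comparison (D.obj g) f ≫ whisker A m hm' f =
      D.algebras.map i ≫ D.algebras.μ (VerticalArrow.of (A.vcomp g f)) ≫ D.comparison g f := by
  have e : D.η (D.obj g) ≫ m = 𝟙 _ := hm ▸ D.algebras.η_μ (VerticalArrow.of g)
  have e' : D.act (D.obj g) ≫ m = P.lift.map m ≫ D.act g :=
    hm ▸ D.algebras.act_μ (VerticalArrow.of g)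
  refine (D.isFree (A.vcomp (D.obj g) f)).hom_ext
    (P.compAct (D.act g) (D.dmap_act (VerticalArrow.of g)) f)
    (P.unit_compAct _ _ _ (D.isFree g).unit_act) ?_ ?_ ?_
  · have h₁ := whisker_comp f (D.η (D.obj g)) m _ (D.dmap_η (D.obj g)) hm' (A.dmap_id _) e
    rw [reassoc_of% (D.η_comparison (D.obj g) f), h₁, whisker_id f _ _ rfl]
    refine Eq.trans ?_ (D.algebras.η_map_assoc i _).symm
    exact hi.symm.trans (congrArg (i ≫ ·) (D.algebras.η_μ_assoc _).symm)
  · exact act_comp (T := P.pointed) (D.act_comparison (D.obj g) f) (P.compAct_whisker _ _ f _ _ m hm' e')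
  · exact act_comp (D.algebras.act_map i) (act_comp
      (D.algebras.act_μ (VerticalArrow.of (A.vcomp g f))) (D.act_comparison g f))

/-- The `A`-point over the free monad that consists of the free algebras. Its `θ` is the inverse of
the comparison map. -/
noncomputable def monadPoint (U : NotionOfComposableStructure A)
    (hγ : ∀ X, IsFreeAlgebra T (F.η.app X) (freeAct γ X)) : MonadPoint A F where
  lift :=
    { obj := D.obj
      map := D.algebras.map
      map_id := D.algebras.map_id
      map_comp := D.algebras.map_comp
      dmap_map := D.dmap_map
      cmap_map := D.cmap_map hγ }
  unit := D.algebras.monad.η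
  dmap_unit f := D.dmap_η f.arr
  cmap_unit f := D.cmap_η f.arr
  θ g f :=
    have := D.isIso_comparison g f U hγ
    (asIso (D.comparison g f)).symm
  θ_naturality {X Y Z X' Y' Z' g f g' f'} σ β h := by
    have := D.isIso_comparison g f U hγ
    have := D.isIso_comparison g' f' U hγ
    have h₁ := D.comparison_naturality σ β h _ rfl ((D.dmap_map σ).trans h)
    exact (IsIso.comp_inv_eq (D.comparison g' f')).2 (((IsIso.eq_inv_comp (D.comparison g f)).2
      h₁).trans (Category.assoc _ _ _).symm)
  unit_θ {X Y Z} g f := by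
    have := D.isIso_comparison g f U hγ
    exact (IsIso.comp_inv_eq (D.comparison g f)).2 (D.η_comparison g f).symm
  mul := D.algebras.monad.μ
  dmap_mul f := D.dmap_μ f
  cmap_mul f := D.cmap_μ hγ f
  unit_mul f := D.algebras.η_μ f
  map_unit_mul f := D.algebras.map_η_μ f
  mul_assoc f := D.algebras.μ_assoc f
  mul_θ {X Y Z} g f := by
    have := D.isIso_comparison g f U hγ
    have := D.isIso_comparison (D.obj g) f U hγ
    have h₁ := D.comparison_μ g f (inv (D.comparison g f)) (IsIso.inv_hom_id _) _ rfl
      (D.dmap_μ (VerticalArrow.of g))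
    exact (IsIso.comp_inv_eq (D.comparison g f)).2
      (((IsIso.eq_inv_comp (D.comparison (D.obj g) f)).2 h₁).trans
        ((congrArg (inv (D.comparison (D.obj g) f) ≫ ·) (Category.assoc _ _ _).symm).trans
          (Category.assoc _ _ _).symm))

/-- The universal morphism from an `A`-point over `T` to the one over the free monad. -/
noncomputable def pointHom (U : NotionOfComposableStructure A)
    (hγ : ∀ X, IsFreeAlgebra T (F.η.app X) (freeAct γ X)) :
    PointHom P (D.monadPoint U hγ).toPoint γ where
  nat := D.algebras.toMonad.nat
  unit_nat := D.algebras.toMonad.unit_nat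
  dmap_nat f := by
    refine (A.dmap_comp _ _).trans ((congrArg₂ (· ≫ ·) (P.lift.dmap_map _)
      (D.dmap_act f)).trans ((Category.comp_id _).trans (D.dmap_η f.arr)))
  cmap_nat f := by
    refine (A.cmap_comp _ _).trans ((congrArg₂ (· ≫ ·) (P.lift.cmap_map _)
      (D.cmap_act f.arr)).trans ?_)
    exact (congrArg (T.functor.map · ≫ freeAct γ f.tgt) (D.cmap_η f.arr)).trans
      (map_η_freeAct γ f.tgt)
  nat_θ {X Y Z} g f := by
    have := D.isIso_comparison g f U hγ
    refine (IsIso.comp_inv_eq (D.comparison g f)).2 ?_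
    have hη := D.dmap_η g
    have hact := D.dmap_act (VerticalArrow.of g)
    have h₁ : D.algebras.ι (VerticalArrow.of (A.vcomp g f)) ≫ D.comparison g f =
        P.lift.map (whisker A (D.η g) hη f) ≫ P.compAct (D.act g) hact f :=
      (Category.assoc _ _ _).trans ((congrArg (P.lift.functor.map _ ≫ ·)
        (D.act_comparison g f)).trans ((Category.assoc _ _ _).symm.trans
          (congrArg (· ≫ P.compAct (D.act g) hact f) ((P.lift.map_comp _ _).symm.trans
            (congrArg P.lift.map (D.η_comparison g f))))))
    have h₂ := P.θ_naturality (D.η g) (𝟙 (VerticalArrow.of f))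
      (hη.trans (A.cmap_id (VerticalArrow.of f)).symm)
    let w : VerticalArrow.of (P.lift.obj g) ⟶ VerticalArrow.of (P.lift.obj (D.obj g)) :=
      P.lift.map (D.η g)
    have hw : A.dmap w = 𝟙 Y := (P.lift.dmap_map (D.η g)).trans hη
    have h₃ := whisker_comp f w (D.act g) _ hw hact
      ((A.dmap_comp _ _).trans ((congrArg₂ (· ≫ ·) hw hact).trans (Category.comp_id _))) rfl
    have h₄ : (P.θ g f).hom ≫ P.lift.map (whisker A (D.η g) hη f) ≫ P.compAct (D.act g) hact f =
        whisker A w hw f ≫ whisker A (D.act g) hact f := by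
      have h₅ : (P.θ g f).hom ≫ P.lift.map (whisker A (D.η g) hη f) =
        whisker A w hw f ≫ (P.θ (D.obj g) f).hom := h₂.symm
      have h₆ : (P.θ (D.obj g) f).hom ≫ P.compAct (D.act g) hact f =
        whisker A (D.act g) hact f := Iso.hom_inv_id_assoc _ _
      rw [reassoc_of% h₅, h₆]
    exact h₃.symm.trans (h₄.symm.trans ((congrArg ((P.θ g f).hom ≫ ·) h₁.symm).trans
      (Category.assoc _ _ _).symm))

end FreePoints

end FreeMonadPoint

/-! ### The universal property among points -/

section UniversalProperty

variable {E : Type u} [Category.{v} E] {A : PseudoDoubleCategory.{v, u, v', u'} E}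
  {T : PointedEndofunctor E} {P : Point A T} {F F' : Monad E} {γ : T ⟶ underPtd F}

/-- The monad on vertical morphisms underlying an `A`-point over a monad. -/
def MonadPoint.monad (Q : MonadPoint A F) : Monad A.VertArr where
  toFunctor := Q.lift.functor
  η := Q.unit
  μ := Q.mul
  assoc := Q.mul_assoc
  left_unit := Q.unit_mul
  right_unit := Q.map_unit_mul

/-- The morphism of pointed endofunctors on vertical morphisms underlying a morphism of
`A`-points. -/
def PointHom.pointedHom {Q : MonadPoint A F} (β : PointHom P Q.toPoint γ) :
    P.pointed ⟶ underPtd Q.monad :=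
  PointedEndofunctor.Hom.mk β.nat β.unit_nat

/-- The isomorphisms `θ` of an `A`-point over a monad are maps of algebras for an `A`-point over
a pointed endofunctor that maps to it. -/
theorem PointHom.compAct_θ {Q : MonadPoint A F} (β : PointHom P Q.toPoint γ) {X Y Z : E}
    (g : A.Vert Y Z) (f : A.Vert X Y)
    (b : VerticalArrow.of (P.lift.obj (Q.lift.obj g)) ⟶ VerticalArrow.of (Q.lift.obj g))
    (hb : b = freeAct β.pointedHom (VerticalArrow.of g)) (hb' : A.dmap b = 𝟙 Y) :
    P.compAct b hb' f ≫ (Q.θ g f).hom = P.lift.map (Q.θ g f).hom ≫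
      freeAct β.pointedHom (VerticalArrow.of (A.vcomp g f)) := by
  subst hb
  let β₁ : VerticalArrow.of (P.lift.obj (Q.lift.obj g)) ⟶
    VerticalArrow.of (Q.lift.obj (Q.lift.obj g)) := β.nat.app (VerticalArrow.of (Q.lift.obj g))
  let m : VerticalArrow.of (Q.lift.obj (Q.lift.obj g)) ⟶ VerticalArrow.of (Q.lift.obj g) :=
    Q.mul.app (VerticalArrow.of g)
  have hβ₁ : A.dmap β₁ = 𝟙 Y := β.dmap_nat _
  have hm : A.dmap m = 𝟙 Y := Q.dmap_mul _
  have h₁ := whisker_comp f β₁ m _ hβ₁ hm hb' rfl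
  let m₂ : VerticalArrow.of (Q.lift.obj (Q.lift.obj (A.vcomp g f))) ⟶
    VerticalArrow.of (Q.lift.obj (A.vcomp g f)) := Q.mul.app (VerticalArrow.of (A.vcomp g f))
  let β₂ : VerticalArrow.of (P.lift.obj (A.vcomp (Q.lift.obj g) f)) ⟶
    VerticalArrow.of (Q.lift.obj (A.vcomp (Q.lift.obj g) f)) :=
    β.nat.app (VerticalArrow.of (A.vcomp (Q.lift.obj g) f))
  let β₃ : VerticalArrow.of (P.lift.obj (Q.lift.obj (A.vcomp g f))) ⟶
    VerticalArrow.of (Q.lift.obj (Q.lift.obj (A.vcomp g f))) :=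
    β.nat.app (VerticalArrow.of (Q.lift.obj (A.vcomp g f)))
  let p : VerticalArrow.of (P.lift.obj (A.vcomp (Q.lift.obj g) f)) ⟶
    VerticalArrow.of (P.lift.obj (Q.lift.obj (A.vcomp g f))) := P.lift.map (Q.θ g f).hom
  let q : VerticalArrow.of (Q.lift.obj (A.vcomp (Q.lift.obj g) f)) ⟶
    VerticalArrow.of (Q.lift.obj (Q.lift.obj (A.vcomp g f))) := Q.lift.map (Q.θ g f).hom
  have h₂ : whisker A m hm f ≫ (Q.θ g f).hom = (Q.θ (Q.lift.obj g) f).hom ≫ q ≫ m₂ := Q.mul_θ g f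
  have h₃ : whisker A β₁ hβ₁ f ≫ (Q.θ (Q.lift.obj g) f).hom = (P.θ (Q.lift.obj g) f).hom ≫ β₂ :=
    β.nat_θ _ _
  have h₄ : p ≫ β₃ = β₂ ≫ q := β.nat.naturality (Q.θ g f).hom
  refine (Category.assoc _ _ _).trans ((Iso.inv_comp_eq _).2 ?_)
  have h₅ : whisker A β₁ hβ₁ f ≫ whisker A m hm f ≫ (Q.θ g f).hom =
      (P.θ (Q.lift.obj g) f).hom ≫ p ≫ β₃ ≫ m₂ := by
    rw [h₂, reassoc_of% h₃, reassoc_of% h₄]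
  exact (congrArg (· ≫ (Q.θ g f).hom) h₁.symm).trans ((Category.assoc _ _ _).trans h₅)

namespace FreePoints

variable (D : FreePoints P γ)

/-- The universal property of the `A`-point of free algebras. The morphism is obtained from the free
monad on vertical morphisms; freeness in `E` shows that it lies over `α`. -/
theorem existsUnique_monadPointHom (U : NotionOfComposableStructure A)
    (hγ : ∀ X, IsFreeAlgebra T (F.η.app X) (freeAct γ X)) (α : F ⟶ F') (Q : MonadPoint A F')
    (β : PointHom P Q.toPoint (γ ≫ underPtdMap α)) :
    ∃! α' : MonadPointHom (D.monadPoint U hγ) Q α, (D.pointHom U hγ).nat ≫ α'.nat = β.nat := by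
  obtain ⟨δ, hδ, hδ'⟩ := D.algebras.isFreeMonad Q.monad β.pointedHom
  let d (f : A.VertArr) : D.algebras.obj f ⟶ VerticalArrow.of (Q.lift.obj f.arr) := δ.app f
  let b (f : A.VertArr) : VerticalArrow.of (P.lift.obj (Q.lift.obj f.arr)) ⟶
    VerticalArrow.of (Q.lift.obj f.arr) := freeAct β.pointedHom f
  have unit_b (f : A.VertArr) : P.unit.app (VerticalArrow.of (Q.lift.obj f.arr)) ≫ b f = 𝟙 _ :=
    unit_freeAct β.pointedHom f
  have η_d (f : A.VertArr) : D.algebras.η f ≫ d f = Q.unit.app f := δ.app_η f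
  have act_d (f : A.VertArr) : D.algebras.act f ≫ d f = P.lift.functor.map (d f) ≫ b f := by
    have h₁ := freeAct_hom D.algebras.toMonad δ f
    rw [hδ, D.algebras.freeAct_toMonad] at h₁
    exact h₁
  have dmap_d (f : A.VertArr) : A.dmap (d f) = 𝟙 f.src :=
    (D.dmap_η_comp (d f)).symm.trans ((congrArg A.dmap (η_d f)).trans (Q.dmap_unit f))
  have cmap_b (f : A.VertArr) : A.cmap (b f) = freeAct (γ ≫ underPtdMap α) f.tgt :=
    (A.cmap_comp _ _).trans (congrArg₂ (· ≫ ·) (β.cmap_nat _) (Q.cmap_mul f))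
  have cmap_d (f : A.VertArr) : A.cmap (d f) = α.app f.tgt := by
    refine D.cmap_eq hγ (d f) (b f) (unit_b f) (act_d f) _ ?_ ?_
    · rw [η_d]
      exact (α.app_η f.tgt).trans (Q.cmap_unit f).symm
    · rw [cmap_b]
      exact freeAct_hom γ α f.tgt
  have d_θ : ∀ {X Y Z : E} (g : A.Vert Y Z) (f : A.Vert X Y),
      whisker A (d (VerticalArrow.of g)) (dmap_d (VerticalArrow.of g)) f ≫ (Q.θ g f).hom =
        ((D.monadPoint U hγ).θ g f).hom ≫ d (VerticalArrow.of (A.vcomp g f)) := by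
    intro X Y Z g f
    have := D.isIso_comparison g f U hγ
    refine (IsIso.eq_inv_comp (D.comparison g f)).2 ?_
    have hb : A.dmap (b (VerticalArrow.of g)) = 𝟙 Y := P.dmap_act _ (unit_b _)
    refine (D.isFree (A.vcomp g f)).hom_ext _ (unit_b (VerticalArrow.of (A.vcomp g f))) ?_ ?_
      (act_d (VerticalArrow.of (A.vcomp g f)))
    · have h₁ := whisker_comp f (D.η g) (d (VerticalArrow.of g)) _ (D.dmap_η g)
        (dmap_d (VerticalArrow.of g)) (Q.dmap_unit (VerticalArrow.of g)) (η_d (VerticalArrow.of g))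
      rw [reassoc_of% (D.η_comparison g f), reassoc_of% h₁]
      exact (Q.unit_θ g f).trans (η_d (VerticalArrow.of (A.vcomp g f))).symm
    · exact act_comp (T := P.pointed) (D.act_comparison g f) (act_comp (T := P.pointed)
        (P.compAct_whisker _ _ f _ hb _ _ (act_d (VerticalArrow.of g)))
        (β.compAct_θ g f _ rfl hb))
  refine ⟨
    { nat := δ.toNatTrans
      unit_nat := (underPtdMap δ).unit_nat
      dmap_nat := dmap_d
      cmap_nat := cmap_d
      nat_θ := d_θ
      mul_nat := fun f => (δ.app_μ f).trans (Category.assoc _ _ _) }, ?_, fun α' hα' => ?_⟩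
  · exact congrArg PointedEndofunctor.Hom.nat hδ
  · let δ' : D.algebras.monad ⟶ Q.monad :=
      { toNatTrans := α'.nat
        app_η := fun f => congrArg (fun t => t.app f) α'.unit_nat
        app_μ := fun f => (α'.mul_nat f).trans (Category.assoc _ _ _).symm }
    have : δ' = δ := hδ' δ' (PointedEndofunctor.Hom.ext hα')
    have h : α'.nat = δ.toNatTrans := congrArg MonadHom.toNatTrans this
    exact MonadPointHom.ext h

end FreePoints

end UniversalProperty

end FreeMonadPoints

theorem mainTheorem2 {E : Type u} [Category.{v} E]
    (κ : Ordinal.{w}) (hκ : Order.IsSuccLimit κ)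
    (M : MorphismProperty E) (T : PointedEndofunctor E) (hT : IsConfiguration κ M T)
    (A : PseudoDoubleCategory.{v, u, v', u'} E) (U : NotionOfComposableStructure A)
    (hU : U.IsCellular κ M) (P : Point A T) :
    (∃ (F : Monad E) (γ : T ⟶ underPtd F), IsFreeMonad γ) ∧
    ∀ (F : Monad E) (γ : T ⟶ underPtd F), IsFreeMonad γ →
      ∃ (Q : MonadPoint A F) (γ' : PointHom P Q.toPoint γ),
        ∀ (F' : Monad E) (α : F ⟶ F') (Q' : MonadPoint A F')
          (β : PointHom P Q'.toPoint (γ ≫ underPtdMap α)),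
          ∃! α' : MonadPointHom Q Q' α, γ'.nat ≫ α'.nat = β.nat := by
  choose obj η act isFree using hT.exists_isFreeAlgebra hκ
  let L : FreeAlgebras T := ⟨obj, η, act, isFree⟩
  refine ⟨⟨L.monad, L.toMonad, L.isFreeMonad⟩, fun F γ hγ => ?_⟩
  have hγ' := hγ.isFreeAlgebra L
  obtain ⟨D⟩ := exists_freePoints hT hκ U hU P γ hγ'
  exact ⟨D.monadPoint U hγ', D.pointHom U hγ', fun F' α Q β =>
    D.existsUnique_monadPointHom U hγ' α Q β⟩
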